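/- Let $d_A,d_B\ge 0$ be integers and $\mathcal H_{AB}=\mathbb C^{d_A}\otimes\mathbb C^{d_B}$, the first factor held by Alice and the second by Bob. A property $\mathcal P=(\mathcal P^{\mathrm{yes}},\mathcal P^{\mathrm{no}})$ is a pair of disjoint sets of density operators on $\mathcal H_{AB}$. For $0<s<c\le 1$, a $(c,s)$-tester for $\mathcal P$ with sample complexity $N$ is an operator $0\sqsubseteq \mathcal T\sqsubseteq I$ on $\mathcal H_{AB}^{\otimes N}$ (with $\sqsubseteq$ the Löwner order) such that $\operatorname{tr}[\mathcal T\rho^{\otimes N}]\ge c$ for all $\rho\in\mathcal P^{\mathrm{yes}}$ and $\operatorname{tr}[\mathcal T\rho^{\otimes N}]\le s$ for all $\rho\in\mathcal P^{\mathrm{no}}$; $\mathsf S_{c,s}(\mathcal P)$ denotes the least $N\ge 0$ for which such a tester exists ($\infty$ if there is none). The tester is one-way LOCC from Bob to Alice if $\mathcal T=\sum_{m=1}^{k}A_m\otimes B_m$, where $k$ is finite, $(B_m)_{m}$ is a POVM on $(\mathbb C^{d_B})^{\otimes N}$ (Bob's measurement, whose outcome $m$ he sends to Alice) and $0\sqsubseteq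 A_m\sqsubseteq I$ on $(\mathbb C^{d_A})^{\otimes N}$ (Alice's accepting effect upon receiving $m$). **Theorem.** Suppose that $\mathcal P$ is unitarily invariant on Bob's part, i.e. $(I\otimes U)\rho(I\otimes U)^\dagger\in\mathcal P^{X}$ for every $X\in\{\mathrm{yes},\mathrm{no}\}$, every $\rho\in\mathcal P^{X}$ and every unitary $U$ on $\mathbb C^{d_B}$, and that $\mathcal P^{\mathrm{yes}}$ contains only pure states. Let $0<s<c\le 1$ and suppose that $\mathsf S_{c,s}(\mathcal P)<\infty$. Then there is a one-way LOCC (from Bob to Alice) $(c,s)$-tester for $\mathcal P$ whose sample complexity $N$ satisfies $$N\le \frac{200\,\ln(1/s+10)}{(c-s)^{4}}\cdot \mathsf S_{c,s}(\mathcal P).$$ -/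

import Mathlib

open scoped Kronecker Matrix ComplexOrder

noncomputable section

namespace StateTesting

/-- Operators on the Hilbert space `ℂ^n` with standard basis indexed by `n`. -/
abbrev Op (n : Type) := Matrix n n ℂ

/-- A mixed state (density operator): positive semidefinite with trace one. -/
def IsDensity {n : Type} [Fintype n] (ρ : Op n) : Prop :=
  ρ.PosSemidef ∧ ρ.trace = 1

/-- A pure state: `ρ = |ψ⟩⟨ψ|` for a unit vector `ψ`. -/
def IsPure {n : Type} [Fintype n] (ρ : Op n) : Prop :=
  ∃ ψ : n → ℂ, star ψ ⬝ᵥ ψ = 1 ∧ ρ = Matrix.vecMulVec ψ (star ψ)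

/-- A measurement effect: `0 ⊑ T ⊑ I` in the Löwner order. -/
def IsEffect {n : Type} [Fintype n] [DecidableEq n] (T : Op n) : Prop :=
  T.PosSemidef ∧ (1 - T).PosSemidef

/-- The tensor power `ρ^{⊗N}`, an operator on `(ℂ^n)^{⊗N}`, whose standard basis is indexed by
`Fin N → n`. -/
def tensorPower {n : Type} (N : ℕ) (ρ : Op n) : Op (Fin N → n) :=
  Matrix.of fun x y => ∏ i, ρ (x i) (y i)

/-- A property of mixed states: a disjoint pair of sets of density operators. -/
structure Property (n : Type) [Fintype n] where
  yes : Set (Op n)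
  no : Set (Op n)
  yes_density : ∀ ρ ∈ yes, IsDensity ρ
  no_density : ∀ ρ ∈ no, IsDensity ρ
  disjoint : Disjoint yes no

/-- `T` is a `(c, s)`-tester for `P` with sample complexity `N`. The acceptance probability
`tr[T ρ^{⊗N}]` is a real number, so that taking the real part only changes its type. -/
def IsTester {n : Type} [Fintype n] [DecidableEq n] (P : Property n) (c s : ℝ) (N : ℕ)
    (T : Op (Fin N → n)) : Prop :=
  IsEffect T ∧
  (∀ ρ ∈ P.yes, c ≤ (T * tensorPower N ρ).trace.re) ∧
  (∀ ρ ∈ P.no, (T * tensorPower N ρ).trace.re ≤ s)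

/-- The `(c, s)`-sample complexity of `P`: the least sample complexity of a `(c, s)`-tester
for `P`, and `⊤` if there is no such tester. -/
def sampleComplexity {n : Type} [Fintype n] [DecidableEq n] (P : Property n) (c s : ℝ) : ℕ∞ :=
  ⨅ (N : ℕ) (_ : ∃ T : Op (Fin N → n), IsTester P c s N T), (N : ℕ∞)

/-- A property of bipartite states on `ℂ^a ⊗ ℂ^b` (Alice holds `ℂ^a`, Bob holds `ℂ^b`) is
unitarily invariant on Bob's part. -/
def UnitarilyInvariantOnB {a b : Type} [Fintype a] [DecidableEq a] [Fintype b] [DecidableEq b]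
    (P : Property (a × b)) : Prop :=
  ∀ U ∈ Matrix.unitaryGroup b ℂ,
    (∀ ρ ∈ P.yes, ((1 : Op a) ⊗ₖ U) * ρ * ((1 : Op a) ⊗ₖ U)ᴴ ∈ P.yes) ∧
    (∀ ρ ∈ P.no, ((1 : Op a) ⊗ₖ U) * ρ * ((1 : Op a) ⊗ₖ U)ᴴ ∈ P.no)

/-- The operator `A ⊗ B` on `(ℂ^a ⊗ ℂ^b)^{⊗N} ≅ (ℂ^a)^{⊗N} ⊗ (ℂ^b)^{⊗N}`, for `A` on Alice's
`N` systems and `B` on Bob's. -/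
def localProd {a b : Type} {N : ℕ} (A : Op (Fin N → a)) (B : Op (Fin N → b)) :
    Op (Fin N → a × b) :=
  (A ⊗ₖ B).submatrix (Equiv.arrowProdEquivProdArrow (Fin N) (fun _ => a) (fun _ => b))
    (Equiv.arrowProdEquivProdArrow (Fin N) (fun _ => a) (fun _ => b))

/-- One-way LOCC (Bob to Alice) testers: Bob performs a measurement (a POVM `B`) on his `N`
systems and sends the outcome `m`, one of finitely many classical messages, to Alice; Alice then
performs a two-outcome measurement on her `N` systems, with accepting effect `A m`. The operator
of this strategy is `∑ m, A m ⊗ B m`. -/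
def IsOneWayLOCC {a b : Type} [Fintype a] [DecidableEq a] [Fintype b] [DecidableEq b] {N : ℕ}
    (T : Op (Fin N → a × b)) : Prop :=
  ∃ (k : ℕ) (B : Fin k → Op (Fin N → b)) (A : Fin k → Op (Fin N → a)),
    (∀ m, (B m).PosSemidef) ∧ ∑ m, B m = 1 ∧ (∀ m, IsEffect (A m)) ∧
    T = ∑ m, localProd (A m) (B m)

end StateTesting

end

noncomputable section

namespace StateTesting

set_option linter.unusedSectionVars false

section PosSemidef

variable {n m : Type} [Fintype n] [DecidableEq n] [Fintype m] [DecidableEq m]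

open scoped MatrixOrder in
theorem exists_eq_conjTranspose_mul_self {A : Op n} (hA : A.PosSemidef) :
    ∃ B : Op n, A = Bᴴ * B := by
  obtain ⟨B, hB⟩ := CStarAlgebra.nonneg_iff_eq_star_mul_self.mp
    (Matrix.nonneg_iff_posSemidef.mpr hA)
  exact ⟨B, hB⟩

theorem trace_mul_nonneg {A B : Op n} (hA : A.PosSemidef) (hB : B.PosSemidef) :
    0 ≤ (A * B).trace := by
  obtain ⟨C, rfl⟩ := exists_eq_conjTranspose_mul_self hA
  rw [Matrix.mul_assoc, Matrix.trace_mul_comm]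
  exact (hB.mul_mul_conjTranspose_same C).trace_nonneg

theorem trace_mul_re_nonneg {A B : Op n} (hA : A.PosSemidef) (hB : B.PosSemidef) :
    0 ≤ (A * B).trace.re :=
  (Complex.le_def.mp (trace_mul_nonneg hA hB)).1

theorem ofReal_trace_mul_re {A B : Op n} (hA : A.PosSemidef) (hB : B.PosSemidef) :
    (((A * B).trace.re : ℝ) : ℂ) = (A * B).trace := by
  apply Complex.ext
  · simp
  · simpa using (Complex.le_def.mp (trace_mul_nonneg hA hB)).2

theorem IsEffect.trace_mul_re_le {A B : Op n} (hA : IsEffect A) (hB : B.PosSemidef) :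
    (A * B).trace.re ≤ B.trace.re := by
  have h := trace_mul_re_nonneg hA.2 hB
  rw [Matrix.sub_mul, Matrix.one_mul, Matrix.trace_sub, Complex.sub_re] at h
  linarith

theorem IsEffect.compl {A : Op n} (hA : IsEffect A) : IsEffect (1 - A) :=
  ⟨hA.2, by simpa using hA.1⟩

theorem isEffect_one : IsEffect (1 : Op n) :=
  ⟨Matrix.PosSemidef.one, by simpa using Matrix.PosSemidef.zero⟩

theorem IsEffect.kronecker {A : Op n} {B : Op m} (hA : IsEffect A) (hB : IsEffect B) :
    IsEffect (A ⊗ₖ B) := by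
  refine ⟨hA.1.kronecker hB.1, ?_⟩
  have h : (1 : Op (n × m)) - A ⊗ₖ B = (1 - A) ⊗ₖ (1 : Op m) + A ⊗ₖ (1 - B) := by
    rw [← Matrix.one_kronecker_one]
    ext ⟨i, j⟩ ⟨i', j'⟩
    simp only [Matrix.sub_apply, Matrix.add_apply, Matrix.kroneckerMap_apply]
    ring
  rw [h]
  exact (hA.2.kronecker Matrix.PosSemidef.one).add (hA.1.kronecker hB.2)

theorem IsEffect.submatrix_equiv {A : Op n} (hA : IsEffect A) (e : m ≃ n) :
    IsEffect (A.submatrix e e) := by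
  refine ⟨hA.1.submatrix e, ?_⟩
  have h := hA.2.submatrix e
  rwa [Matrix.submatrix_sub, Pi.sub_apply, Pi.sub_apply, Matrix.submatrix_one_equiv] at h

theorem trace_submatrix_mul_submatrix (A B : Op n) (e : m ≃ n) :
    (A.submatrix e e * B.submatrix e e).trace = (A * B).trace := by
  rw [Matrix.submatrix_mul_equiv]
  exact Fintype.sum_equiv e _ _ (fun _ => rfl)

theorem trace_kronecker_mul_kronecker (A B : Op n) (C D : Op m) :
    ((A ⊗ₖ C) * (B ⊗ₖ D)).trace = (A * B).trace * (C * D).trace := by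
  rw [← Matrix.mul_kronecker_mul, Matrix.trace_kronecker]

end PosSemidef

section PiKron

variable {κ : Type} [Fintype κ] [DecidableEq κ] {n : Type} [Fintype n] [DecidableEq n]

/-- The tensor product of a family of operators on the same space. -/
def piKron {κ : Type} [Fintype κ] {n : Type} (T : κ → Op n) : Op (κ → n) :=
  Matrix.of fun x y => ∏ k, T k (x k) (y k)

theorem piKron_mul (S T : κ → Op n) : piKron (fun k => S k * T k) = piKron S * piKron T := by
  ext x y
  simp only [piKron, Matrix.of_apply, Matrix.mul_apply]
  rw [Finset.prod_univ_sum, Fintype.piFinset_univ]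
  exact Finset.sum_congr rfl fun z _ => Finset.prod_mul_distrib

theorem conjTranspose_piKron (T : κ → Op n) : (piKron T)ᴴ = piKron fun k => (T k)ᴴ := by
  ext x y
  simp [piKron, Matrix.conjTranspose_apply]

theorem piKron_one : piKron (fun _ : κ => (1 : Op n)) = 1 := by
  ext x y
  simp only [piKron, Matrix.of_apply, Matrix.one_apply]
  rw [Finset.prod_ite_zero]
  simp [funext_iff]

theorem posSemidef_piKron {T : κ → Op n} (hT : ∀ k, (T k).PosSemidef) :
    (piKron T).PosSemidef := by
  choose B hB using fun k => exists_eq_conjTranspose_mul_self (hT k)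
  rw [show T = fun k => (B k)ᴴ * B k from funext hB, piKron_mul, ← conjTranspose_piKron]
  exact Matrix.posSemidef_conjTranspose_mul_self _

theorem trace_piKron (T : κ → Op n) : (piKron T).trace = ∏ k, (T k).trace := by
  simp only [Matrix.trace, Matrix.diag, piKron, Matrix.of_apply]
  rw [Finset.prod_univ_sum, Fintype.piFinset_univ]

theorem piKron_add (S T : κ → Op n) :
    piKron (fun k => S k + T k) = ∑ I : Finset κ, piKron fun k => if k ∈ I then S k else T k := by
  ext x y
  simp only [piKron, Matrix.of_apply, Matrix.add_apply, Matrix.sum_apply]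
  rw [Fintype.prod_add]
  refine Finset.sum_congr rfl fun I _ => ?_
  rw [← Finset.prod_mul_prod_compl I]
  congr 1
  · exact Finset.prod_congr rfl fun k hk => by simp [hk]
  · exact Finset.prod_congr rfl fun k hk => by simp [Finset.mem_compl.mp hk]

theorem posSemidef_piKron_add_sub {S T : κ → Op n} (hS : ∀ k, (S k).PosSemidef)
    (hT : ∀ k, (T k).PosSemidef) : (piKron (fun k => S k + T k) - piKron S).PosSemidef := by
  have h : piKron S = piKron fun k => if k ∈ (Finset.univ : Finset κ) then S k else T k := by simp
  rw [piKron_add, h, ← Finset.sum_erase_eq_sub (Finset.mem_univ _)]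
  refine Matrix.posSemidef_sum _ fun I _ => posSemidef_piKron fun k => ?_
  split_ifs
  exacts [hS k, hT k]

theorem IsEffect.piKron {T : κ → Op n} (hT : ∀ k, IsEffect (T k)) :
    IsEffect (StateTesting.piKron T) := by
  refine ⟨posSemidef_piKron fun k => (hT k).1, ?_⟩
  have h := posSemidef_piKron_add_sub (fun k => (hT k).1) (fun k => (hT k).2)
  simpa [piKron_one] using h

/-- Apply the effect `L` to every block and accept if at least `t` blocks accept. -/
def thresholdEffect (κ : Type) [Fintype κ] [DecidableEq κ] (t : ℕ) (L : Op n) : Op (κ → n) :=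
  ∑ I : Finset κ with t ≤ I.card, piKron fun k => if k ∈ I then L else 1 - L

theorem isEffect_thresholdEffect (t : ℕ) {L : Op n} (hL : IsEffect L) :
    IsEffect (thresholdEffect κ t L) := by
  have hpsd : ∀ I : Finset κ, (piKron fun k => if k ∈ I then L else 1 - L).PosSemidef := by
    refine fun I => posSemidef_piKron fun k => ?_
    split_ifs
    exacts [hL.1, hL.2]
  refine ⟨Matrix.posSemidef_sum _ fun I _ => hpsd I, ?_⟩
  have h : (1 : Op (κ → n)) = ∑ I : Finset κ, piKron fun k => if k ∈ I then L else 1 - L := by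
    rw [← piKron_add]
    simp [piKron_one]
  rw [h, thresholdEffect, ← Finset.sum_filter_add_sum_filter_not Finset.univ
    (fun I : Finset κ => t ≤ I.card), add_sub_cancel_left]
  exact Matrix.posSemidef_sum _ fun I _ => hpsd I

/-- The probability that at least `t` of the independent trials indexed by `κ` succeed, each with
success probability `x`. -/
def binomialTail (κ : Type) [Fintype κ] (t : ℕ) (x : ℝ) : ℝ :=
  ∑ I : Finset κ with t ≤ I.card, x ^ I.card * (1 - x) ^ (Fintype.card κ - I.card)

theorem trace_thresholdEffect_mul (t : ℕ) {L ρ : Op n} (hL : IsEffect L) (hρ : IsDensity ρ) :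
    (thresholdEffect κ t L * piKron fun _ => ρ).trace
      = ((binomialTail κ t (L * ρ).trace.re : ℝ) : ℂ) := by
  rw [thresholdEffect, binomialTail, Finset.sum_mul, Matrix.trace_sum, Complex.ofReal_sum]
  refine Finset.sum_congr rfl fun I _ => ?_
  rw [← piKron_mul, trace_piKron, ← Finset.prod_mul_prod_compl I]
  have h1 : ∀ k ∈ I, ((if k ∈ I then L else 1 - L) * ρ).trace = (((L * ρ).trace.re : ℝ) : ℂ) := by
    intro k hk
    rw [if_pos hk, ofReal_trace_mul_re hL.1 hρ.1]
  have h2 : ∀ k ∈ Iᶜ, ((if k ∈ I then L else 1 - L) * ρ).trace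
      = ((1 - (L * ρ).trace.re : ℝ) : ℂ) := by
    intro k hk
    rw [if_neg (Finset.mem_compl.mp hk), Matrix.sub_mul, Matrix.trace_sub, Matrix.one_mul, hρ.2,
      Complex.ofReal_sub, ofReal_trace_mul_re hL.1 hρ.1, Complex.ofReal_one]
  rw [Finset.prod_congr rfl h1, Finset.prod_congr rfl h2, Finset.prod_const, Finset.prod_const,
    Finset.card_compl]
  push_cast
  rfl

end PiKron

section BinomialTail

theorem one_add_mul_pow_div_le_exp {K t : ℕ} {x g : ℝ} (hx : 0 ≤ x) (hg : 0 < g)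
    (hxg : x + g ≤ 1) (ht : K * (x + g) ≤ t) :
    (1 + x * g) ^ K / (1 + g) ^ t ≤ Real.exp (-(K * g ^ 2 / 2)) := by
  have hlog : g - g ^ 2 / 2 ≤ Real.log (1 + g) := by
    refine le_trans ?_ (Real.le_log_one_add_of_nonneg hg.le)
    rw [le_div_iff₀ (by linarith)]
    nlinarith [pow_pos hg 3]
  have hgg : 0 ≤ g - g ^ 2 / 2 := by nlinarith
  have h1 : (1 + x * g) ^ K ≤ Real.exp (K * (x * g)) := by
    rw [Real.exp_nat_mul]
    refine pow_le_pow_left₀ (by positivity) ?_ K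
    rw [add_comm]
    exact Real.add_one_le_exp _
  have h2 : Real.exp (K * (x + g) * (g - g ^ 2 / 2)) ≤ (1 + g) ^ t := by
    rw [← Real.exp_log (show 0 < 1 + g by linarith), ← Real.exp_nat_mul, Real.exp_le_exp]
    exact mul_le_mul ht hlog hgg (Nat.cast_nonneg t)
  calc (1 + x * g) ^ K / (1 + g) ^ t
      ≤ Real.exp (K * (x * g)) / Real.exp (K * (x + g) * (g - g ^ 2 / 2)) :=
        div_le_div₀ (Real.exp_pos _).le h1 (Real.exp_pos _) h2
    _ = Real.exp (K * (x * g) - K * (x + g) * (g - g ^ 2 / 2)) := (Real.exp_sub _ _).symm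
    _ ≤ Real.exp (-(K * g ^ 2 / 2)) := by
        rw [Real.exp_le_exp]
        have hK : (0 : ℝ) ≤ K := Nat.cast_nonneg K
        have : 0 ≤ K * ((1 - (x + g)) * (g ^ 2 / 2)) :=
          mul_nonneg hK (mul_nonneg (by linarith) (by positivity))
        nlinarith

variable {κ : Type} [Fintype κ]

theorem binomialTail_le_exp {t : ℕ} {x g : ℝ} (hx : 0 ≤ x) (hg : 0 < g)
    (hxg : x + g ≤ 1) (ht : Fintype.card κ * (x + g) ≤ t) :
    binomialTail κ t x ≤ Real.exp (-(Fintype.card κ * g ^ 2 / 2)) := by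
  refine le_trans ?_ (one_add_mul_pow_div_le_exp hx hg hxg ht)
  have hx1 : 0 ≤ 1 - x := by linarith
  have hpos : 0 < (1 + g) ^ t := by positivity
  have hsum : (1 + x * g) ^ Fintype.card κ
      = ∑ I : Finset κ, (x * (1 + g)) ^ I.card * (1 - x) ^ (Fintype.card κ - I.card) := by
    rw [Fintype.sum_pow_mul_eq_add_pow]
    ring
  rw [le_div_iff₀ hpos, hsum, binomialTail, Finset.sum_mul]
  refine le_trans (Finset.sum_le_sum fun I hI => ?_) (Finset.sum_le_sum_of_subset_of_nonneg
    (Finset.filter_subset _ _) fun I _ _ => by positivity)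
  have hle : (1 + g) ^ t ≤ (1 + g) ^ I.card :=
    pow_le_pow_right₀ (by linarith) (Finset.mem_filter.mp hI).2
  rw [mul_pow, mul_right_comm]
  gcongr

theorem sum_compl_card_mul_pow (a b : ℝ) :
    ∑ I : Finset κ, ((Fintype.card κ - I.card : ℕ) : ℝ) *
        (a ^ I.card * b ^ (Fintype.card κ - I.card))
      = Fintype.card κ * b * (a + b) ^ (Fintype.card κ - 1) := by
  have h1 : HasDerivAt (fun y : ℝ => ∑ I : Finset κ, a ^ I.card * y ^ (Fintype.card κ - I.card))
      (∑ I : Finset κ, a ^ I.card * (((Fintype.card κ - I.card : ℕ) : ℝ) *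
        b ^ (Fintype.card κ - I.card - 1))) b :=
    HasDerivAt.fun_sum fun I _ => (hasDerivAt_pow _ b).const_mul _
  have h2 : HasDerivAt (fun y : ℝ => ∑ I : Finset κ, a ^ I.card * y ^ (Fintype.card κ - I.card))
      (Fintype.card κ * (a + b) ^ (Fintype.card κ - 1)) b := by
    simp only [Fintype.sum_pow_mul_eq_add_pow]
    simpa using ((hasDerivAt_id b).const_add a).fun_pow (Fintype.card κ)
  rw [mul_right_comm, ← h1.unique h2, Finset.sum_mul]
  refine Finset.sum_congr rfl fun I _ => ?_
  rcases Nat.eq_zero_or_pos (Fintype.card κ - I.card) with h | h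
  · simp [h]
  · have := pow_sub_one_mul h.ne' b
    rw [← this]
    ring

theorem one_sub_binomialTail (t : ℕ) (x : ℝ) :
    1 - binomialTail κ t x = ∑ I : Finset κ with ¬ t ≤ I.card,
      x ^ I.card * (1 - x) ^ (Fintype.card κ - I.card) := by
  have h := Finset.sum_filter_add_sum_filter_not Finset.univ (fun I : Finset κ => t ≤ I.card)
    (fun I => x ^ I.card * (1 - x) ^ (Fintype.card κ - I.card))
  rw [Fintype.sum_pow_mul_eq_add_pow, add_sub_cancel, one_pow] at h
  rw [binomialTail]
  linarith

/-- The probability that fewer than `t` trials succeed is linear in the failure probability of a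
single trial, up to an exponentially small factor. -/
theorem one_sub_binomialTail_le {t t' : ℕ} {x g : ℝ} (hx0 : 0 ≤ x) (hx : x ≤ 1) (hg : 0 < g)
    (hxg : 1 - x + g ≤ 1) (htt : t + t' = Fintype.card κ + 1) (ht0 : 0 < t')
    (ht : Fintype.card κ * (1 - x + g) ≤ t') :
    1 - binomialTail κ t x
      ≤ (1 - x) * ((1 + g) / g * Real.exp (-(Fintype.card κ * g ^ 2 / 2))) := by
  set K := Fintype.card κ with hK
  set y := 1 - x with hy
  have hy0 : 0 ≤ y := by linarith
  have ht' : (0 : ℝ) < t' := Nat.cast_pos.mpr ht0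
  have hz : 0 < (1 + g) ^ t' := by positivity
  have hexp := one_add_mul_pow_div_le_exp hy0 hg hxg ht
  have hbound : (1 - binomialTail κ t x) * (t' * (1 + g) ^ t')
      ≤ K * (y * (1 + g)) * (1 + y * g) ^ (K - 1) := by
    have hxy : x + y * (1 + g) = 1 + y * g := by rw [hy]; ring
    rw [← hxy, hK, ← sum_compl_card_mul_pow, one_sub_binomialTail, Finset.sum_mul, ← hK, ← hy]
    refine le_trans (Finset.sum_le_sum fun I hI => ?_) (Finset.sum_le_sum_of_subset_of_nonneg
      (Finset.filter_subset _ _) fun I _ _ => by positivity)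
    have hlt : I.card < t := not_le.mp (Finset.mem_filter.mp hI).2
    have hj : t' ≤ K - I.card := by omega
    have hle : (1 + g) ^ t' ≤ (1 + g) ^ (K - I.card) := pow_le_pow_right₀ (by linarith) hj
    have hj' : (t' : ℝ) ≤ ((K - I.card : ℕ) : ℝ) := Nat.cast_le.mpr hj
    calc x ^ I.card * y ^ (K - I.card) * (t' * (1 + g) ^ t')
        ≤ x ^ I.card * y ^ (K - I.card) * (((K - I.card : ℕ) : ℝ) * (1 + g) ^ (K - I.card)) := by
          gcongr
      _ = _ := by rw [mul_pow]; ring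
  have hpow : (1 + y * g) ^ (K - 1) ≤ (1 + y * g) ^ K :=
    pow_le_pow_right₀ (by nlinarith) (Nat.sub_le _ _)
  have hKt : K * g ≤ t' := by
    refine le_trans ?_ ht
    have : (0 : ℝ) ≤ K := Nat.cast_nonneg K
    nlinarith
  calc 1 - binomialTail κ t x
      ≤ K * (y * (1 + g)) * (1 + y * g) ^ (K - 1) / (t' * (1 + g) ^ t') := by
        rwa [le_div_iff₀ (by positivity)]
    _ ≤ K * (y * (1 + g)) * (1 + y * g) ^ K / (t' * (1 + g) ^ t') := by gcongr
    _ = y * (1 + g) * (K / t') * ((1 + y * g) ^ K / (1 + g) ^ t') := by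
        field_simp
    _ ≤ y * (1 + g) * (1 / g) * Real.exp (-(K * g ^ 2 / 2)) := by
        have h3 : (K : ℝ) / t' ≤ 1 / g := by
          rw [div_le_div_iff₀ ht' hg]
          linarith
        gcongr
    _ = _ := by ring

end BinomialTail

section Commutant

variable {N : ℕ} {b : Type} [Fintype b] [DecidableEq b]

theorem tensorPower_mul (X Y : Op b) :
    tensorPower N (X * Y) = tensorPower N X * tensorPower N Y :=
  piKron_mul (fun _ => X) (fun _ => Y)

theorem tensorPower_diagonal (d : b → ℂ) :
    tensorPower N (Matrix.diagonal d) = Matrix.diagonal fun x : Fin N → b => ∏ i, d (x i) := by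
  ext x y
  simp only [tensorPower, Matrix.of_apply, Matrix.diagonal_apply]
  rw [Finset.prod_ite_zero]
  simp [funext_iff]

theorem exists_perm_comp_eq {ι X : Type} [Fintype ι] [DecidableEq ι] [DecidableEq X] {f g : ι → X}
    (h : ∀ c, Fintype.card {i // f i = c} = Fintype.card {i // g i = c}) :
    ∃ σ : Equiv.Perm ι, g ∘ σ = f :=
  ⟨Equiv.ofFiberEquiv fun c => Fintype.equivOfCardEq (h c),
    funext fun i => Equiv.ofFiberEquiv_map _ i⟩

variable {M : Op (Fin N → b)}

theorem Commute.tensorPower_diagonal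
    (hM : ∀ U ∈ Matrix.unitaryGroup b ℂ, Commute M (tensorPower N U)) (d : b → ℂ) :
    Commute M (tensorPower N (Matrix.diagonal d)) := by
  rw [StateTesting.tensorPower_diagonal]
  ext x y
  rw [Matrix.mul_diagonal, Matrix.diagonal_mul]
  by_cases h0 : M x y = 0
  · simp [h0]
  suffices h : ∃ σ : Equiv.Perm (Fin N), y ∘ σ = x by
    obtain ⟨σ, rfl⟩ := h
    rw [mul_comm]
    congr 1
    exact (Equiv.prod_comp σ fun i => d (y i)).symm
  refine exists_perm_comp_eq fun j => ?_
  obtain ⟨ω, hω⟩ : ∃ ω : ℂ, IsPrimitiveRoot ω (N + 1) :=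
    ⟨_, Complex.isPrimitiveRoot_exp (N + 1) (Nat.succ_ne_zero N)⟩
  have hnorm : star ω * ω = 1 := by
    have h1 : ‖ω‖ = 1 := hω.norm'_eq_one (Nat.succ_ne_zero N)
    rw [Complex.star_def, ← Complex.normSq_eq_conj_mul_self, Complex.normSq_eq_norm_sq, h1]
    norm_num
  have hU : Matrix.diagonal (fun k => if k = j then ω else 1) ∈ Matrix.unitaryGroup b ℂ := by
    rw [Matrix.mem_unitaryGroup_iff', Matrix.star_eq_conjTranspose, Matrix.diagonal_conjTranspose,
      Matrix.diagonal_mul_diagonal, ← Matrix.diagonal_one]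
    congr 1
    ext k
    by_cases hk : k = j
    · simpa [hk] using hnorm
    · simp [hk]
  have hprod : ∀ z : Fin N → b, ∏ i, (if z i = j then ω else 1)
      = ω ^ Fintype.card {i // z i = j} := by
    intro z
    rw [Finset.prod_ite, Finset.prod_const, Finset.prod_const_one, mul_one, Fintype.card_subtype]
  have h := congrFun (congrFun (hM _ hU) x) y
  simp only [StateTesting.tensorPower_diagonal, Matrix.mul_diagonal, Matrix.diagonal_mul,
    hprod] at h
  have h2 := mul_left_cancel₀ h0 (h.trans (mul_comm _ _))
  have hlt : ∀ z : Fin N → b, Fintype.card {i // z i = j} < N + 1 := fun z =>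
    Nat.lt_succ_of_le ((Fintype.card_subtype_le _).trans_eq (Fintype.card_fin N))
  exact (hω.pow_inj (hlt y) (hlt x) h2).symm

theorem Commute.tensorPower_isHermitian
    (hM : ∀ U ∈ Matrix.unitaryGroup b ℂ, Commute M (tensorPower N U)) {H : Op b}
    (hH : H.IsHermitian) : Commute M (tensorPower N H) := by
  rw [hH.spectral_theorem, Unitary.conjStarAlgAut_apply, tensorPower_mul, tensorPower_mul]
  exact ((hM _ hH.eigenvectorUnitary.2).mul_right (Commute.tensorPower_diagonal hM _)).mul_right
    (hM _ (star hH.eigenvectorUnitary).2)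

theorem Commute.tensorPower
    (hM : ∀ U ∈ Matrix.unitaryGroup b ℂ, Commute M (StateTesting.tensorPower N U)) (Z : Op b) :
    Commute M (StateTesting.tensorPower N Z) := by
  obtain ⟨H₁, H₂, h₁, h₂, rfl⟩ : ∃ H₁ H₂ : Op b, H₁.IsHermitian ∧ H₂.IsHermitian ∧
      Z = H₁ + Complex.I • H₂ :=
    ⟨_, _, (realPart Z).2, (imaginaryPart Z).2, (realPart_add_I_smul_imaginaryPart Z).symm⟩
  ext p q
  let P : Polynomial ℂ :=
    ∑ k, Polynomial.C (M p k) *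
        ∏ i, (Polynomial.C (H₁ (k i) (q i)) + Polynomial.X * Polynomial.C (H₂ (k i) (q i)))
      - ∑ k, (∏ i, (Polynomial.C (H₁ (p i) (k i)) + Polynomial.X * Polynomial.C (H₂ (p i) (k i))))
        * Polynomial.C (M k q)
  have hP : ∀ z : ℂ, P.eval z = (M * StateTesting.tensorPower N (H₁ + z • H₂)) p q
      - (StateTesting.tensorPower N (H₁ + z • H₂) * M) p q := by
    intro z
    simp [P, Polynomial.eval_finsetSum, Polynomial.eval_prod, Matrix.mul_apply,
      StateTesting.tensorPower, mul_comm z]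
  have hP0 : P = 0 := by
    refine Polynomial.eq_zero_of_infinite_isRoot P
      ((Set.infinite_range_of_injective Complex.ofReal_injective).mono ?_)
    rintro _ ⟨t, rfl⟩
    have hH : (H₁ + (t : ℂ) • H₂).IsHermitian :=
      h₁.add (by simp [Matrix.IsHermitian, Matrix.conjTranspose_smul, h₂.eq])
    change P.eval _ = 0
    rw [hP, (Commute.tensorPower_isHermitian hM hH).eq, sub_self]
  have := hP Complex.I
  rw [hP0, Polynomial.eval_zero] at this
  exact (sub_eq_zero.mp this.symm)

/-- If a linear functional vanishes on all tensor powers, it vanishes on all operators that are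
invariant under simultaneous permutations of the tensor factors. -/
theorem sum_mul_eq_zero_of_tensorPower {φ : Op (Fin N → b)}
    (hφ : ∀ Z : Op b, ∑ x, ∑ y, φ x y * tensorPower N Z x y = 0) {r : Op (Fin N → b)}
    (hr : ∀ (σ : Equiv.Perm (Fin N)) x y, r (x ∘ σ) (y ∘ σ) = r x y) :
    ∑ x, ∑ y, φ x y * r x y = 0 := by
  classical
  let ty : (Fin N → b) × (Fin N → b) → (b × b →₀ ℕ) := fun p =>
    ∑ i, Finsupp.single (p.1 i, p.2 i) 1
  have hty : ∀ p q, ty p = ty q → r p.1 p.2 = r q.1 q.2 := by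
    intro p q hpq
    obtain ⟨σ, hσ⟩ := exists_perm_comp_eq (f := fun i => (p.1 i, p.2 i))
      (g := fun i => (q.1 i, q.2 i)) (by
        intro c
        have := DFunLike.congr_fun hpq c
        simpa [ty, Finsupp.finsetSum_apply, Finsupp.single_apply, Fintype.card_subtype] using this)
    have h1 : p.1 = q.1 ∘ σ := funext fun i => (congrArg Prod.fst (congrFun hσ i)).symm
    have h2 : p.2 = q.2 ∘ σ := funext fun i => (congrArg Prod.snd (congrFun hσ i)).symm
    rw [h1, h2, hr]
  let P : MvPolynomial (b × b) ℂ := ∑ p, MvPolynomial.monomial (ty p) (φ p.1 p.2)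
  have hP : P = 0 := by
    refine MvPolynomial.funext fun z => ?_
    rw [map_zero, ← hφ (Matrix.of fun i j => z (i, j)), ← Fintype.sum_prod_type']
    simp only [P, map_sum]
    refine Finset.sum_congr rfl fun p _ => ?_
    rw [MvPolynomial.eval_monomial]
    congr 1
    simp only [ty, tensorPower, Matrix.of_apply]
    rw [← Finsupp.prod_finsetSum_index (by simp) (by simp [pow_add])]
    simp [Finsupp.prod_single_index]
  have hcoeff : ∀ m, ∑ p with ty p = m, φ p.1 p.2 = 0 := by
    intro m
    have := congrArg (MvPolynomial.coeff m) hP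
    simpa [P, MvPolynomial.coeff_sum, MvPolynomial.coeff_monomial, Finset.sum_ite] using this
  rw [← Fintype.sum_prod_type', ← Finset.sum_fiberwise_of_maps_to (t := Finset.univ.image ty)
    (g := ty) (fun p _ => Finset.mem_image_of_mem _ (Finset.mem_univ p))]
  refine Finset.sum_eq_zero fun m hm => ?_
  obtain ⟨q, -, rfl⟩ := Finset.mem_image.mp hm
  rw [Finset.sum_congr rfl (g := fun p => φ p.1 p.2 * r q.1 q.2), ← Finset.sum_mul, hcoeff,
    zero_mul]
  intro p hp
  rw [hty p q (Finset.mem_filter.mp hp).2]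

/-- An operator commuting with all `U^{⊗N}`, `U` unitary, commutes with all permutation invariant
operators. -/
theorem commute_of_commute_tensorPower
    (hM : ∀ U ∈ Matrix.unitaryGroup b ℂ, Commute M (tensorPower N U)) {r : Op (Fin N → b)}
    (hr : ∀ (σ : Equiv.Perm (Fin N)) x y, r (x ∘ σ) (y ∘ σ) = r x y) : Commute M r := by
  have key : ∀ (s : Op (Fin N → b)) p q, (M * s) p q - (s * M) p q
      = ∑ x, ∑ y, ((if y = q then M p x else 0) - (if x = p then M y q else 0)) * s x y := by
    intro s p q
    simp only [sub_mul, Finset.sum_sub_distrib, ite_mul, zero_mul, Finset.sum_ite_eq',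
      Finset.mem_univ, if_true, Matrix.mul_apply]
    congr 1
    rw [Finset.sum_comm]
    simp [mul_comm]
  ext p q
  rw [← sub_eq_zero, key]
  refine sum_mul_eq_zero_of_tensorPower (φ := Matrix.of fun x y =>
    (if y = q then M p x else 0) - (if x = p then M y q else 0)) (fun Z => ?_) hr
  simp only [Matrix.of_apply]
  rw [← key, (Commute.tensorPower hM Z).eq, sub_self]

end Commutant

section PseudoInverse

variable {n : Type} [Fintype n] [DecidableEq n]

open scoped MatrixOrder in
/-- The square root of the pseudo-inverse of a positive semidefinite matrix. -/
theorem exists_sqrt_pseudoInverse {C : Op n} (hC : C.PosSemidef) :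
    ∃ S : Op n, S.IsHermitian ∧ (∀ Z, Commute C Z → Commute S Z) ∧ C * (S * S) * C = C := by
  have hCs : IsSelfAdjoint C := hC.isHermitian
  have hcont : ∀ f : ℝ → ℝ, ContinuousOn f (spectrum ℝ C) := fun f =>
    (Matrix.finite_real_spectrum (A := C)).continuousOn f
  refine ⟨cfc (fun x : ℝ => 1 / √x) C, cfc_predicate _ C, fun Z hZ => hZ.cfc_real _, ?_⟩
  conv_lhs => rw [← cfc_id' ℝ C]
  rw [cfc_id' ℝ C]
  nth_rewrite 1 [← cfc_id' ℝ C]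
  nth_rewrite 4 [← cfc_id' ℝ C]
  rw [← cfc_mul _ _ C (hcont _) (hcont _), ← cfc_mul _ _ C (hcont _) (hcont _),
    ← cfc_mul _ _ C (hcont _) (hcont _)]
  conv_rhs => rw [← cfc_id' ℝ C]
  refine cfc_congr fun x hx => ?_
  have hx0 : 0 ≤ x := spectrum_nonneg_of_nonneg (Matrix.nonneg_iff_posSemidef.mpr hC) hx
  rcases hx0.eq_or_lt with rfl | hpos
  · simp
  · have := Real.mul_self_sqrt hx0
    have h2 : √x ≠ 0 := (Real.sqrt_pos.mpr hpos).ne'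
    field_simp
    rw [Real.sq_sqrt hx0]

end PseudoInverse

section PartialTrace

variable {α β : Type} [Fintype α] [DecidableEq α] [Fintype β] [DecidableEq β]

/-- The partial trace over the second factor. -/
def partialTrace (S : Op (α × β)) : Op α :=
  ∑ y, S.submatrix (fun x => (x, y)) (fun x => (x, y))

theorem posSemidef_partialTrace {S : Op (α × β)} (hS : S.PosSemidef) :
    (partialTrace S).PosSemidef :=
  Matrix.posSemidef_sum _ fun _ _ => hS.submatrix _

theorem partialTrace_apply (S : Op (α × β)) (x x' : α) :
    partialTrace S x x' = ∑ y, S (x, y) (x', y) := by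
  simp [partialTrace, Matrix.sum_apply]

theorem partialTrace_sub (S T : Op (α × β)) :
    partialTrace (S - T) = partialTrace S - partialTrace T := by
  ext x x'
  simp [partialTrace_apply]

/-- A vector of a bipartite space, as a rectangular matrix. -/
def toMat (v : α × β → ℂ) : Matrix α β ℂ := Matrix.of fun x y => v (x, y)

/-- A rectangular matrix, as a vector of a bipartite space. -/
def toVec (Y : Matrix α β ℂ) : α × β → ℂ := fun p => Y p.1 p.2

theorem kronecker_one_mulVec_toVec (L : Op α) (Y : Matrix α β ℂ) :
    (L ⊗ₖ (1 : Op β)) *ᵥ toVec Y = toVec (L * Y) := by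
  ext ⟨x, y⟩
  simp [Matrix.mulVec, dotProduct, toVec, Matrix.mul_apply, Fintype.sum_prod_type,
    Matrix.kroneckerMap_apply, Matrix.one_apply]

theorem one_kronecker_mulVec_toVec (r : Op β) (Y : Matrix α β ℂ) :
    ((1 : Op α) ⊗ₖ r) *ᵥ toVec Y = toVec (Y * rᵀ) := by
  ext ⟨x, y⟩
  simp [Matrix.mulVec, dotProduct, toVec, Matrix.mul_apply, Fintype.sum_prod_type,
    Matrix.kroneckerMap_apply, Matrix.one_apply, mul_comm]

theorem toMat_mulVec_mul {T : Op (α × β)} {r : Op β} (hT : Commute T ((1 : Op α) ⊗ₖ rᵀ))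
    (Y : Matrix α β ℂ) : toMat (T *ᵥ toVec (Y * r)) = toMat (T *ᵥ toVec Y) * r := by
  have h := one_kronecker_mulVec_toVec rᵀ Y
  rw [Matrix.transpose_transpose] at h
  rw [← h, Matrix.mulVec_mulVec, hT.eq, ← Matrix.mulVec_mulVec]
  exact congrArg toMat (one_kronecker_mulVec_toVec rᵀ (toMat (T *ᵥ toVec Y)))

theorem toMat_mulVec_sum {ι : Type} (s : Finset ι) (T : Op (α × β)) (Y : ι → Matrix α β ℂ) :
    toMat (T *ᵥ toVec (∑ k ∈ s, Y k)) = ∑ k ∈ s, toMat (T *ᵥ toVec (Y k)) := by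
  have h : toVec (∑ k ∈ s, Y k) = ∑ k ∈ s, toVec (Y k) := by
    ext p
    simp [toVec, Matrix.sum_apply]
  rw [h, Matrix.mulVec_sum]
  ext x y
  simp [toMat, Matrix.sum_apply]

theorem partialTrace_mul_conjTranspose (S P : Op (α × β)) :
    partialTrace (S * Pᴴ) = ∑ k, toMat (S.col k) * (toMat (P.col k))ᴴ := by
  ext x x'
  simp only [partialTrace_apply, Matrix.mul_apply, Matrix.sum_apply, Matrix.conjTranspose_apply]
  rw [Finset.sum_comm]
  rfl

end PartialTrace

section PermMatrix

variable {N : ℕ} {a b c : Type} [Fintype a] [DecidableEq a] [Fintype b] [DecidableEq b]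
  [Fintype c] [DecidableEq c]

/-- A matrix between tensor powers that is invariant under simultaneous permutations of the tensor
factors. -/
def PermInvariant (Y : Matrix (Fin N → a) (Fin N → b) ℂ) : Prop :=
  ∀ (σ : Equiv.Perm (Fin N)) x y, Y (x ∘ σ) (y ∘ σ) = Y x y

theorem sum_comp_perm (σ : Equiv.Perm (Fin N)) (f : (Fin N → a) → ℂ) :
    ∑ x, f (x ∘ σ) = ∑ x, f x :=
  Fintype.sum_equiv (σ.symm.arrowCongr (Equiv.refl a)) _ _ fun _ => rfl

theorem PermInvariant.mul {Y : Matrix (Fin N → a) (Fin N → b) ℂ}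
    {Z : Matrix (Fin N → b) (Fin N → c) ℂ} (hY : PermInvariant Y) (hZ : PermInvariant Z) :
    PermInvariant (Y * Z) := by
  intro σ x y
  simp only [Matrix.mul_apply]
  rw [← sum_comp_perm σ]
  exact Finset.sum_congr rfl fun z _ => by rw [hY, hZ]

theorem PermInvariant.conjTranspose {Y : Matrix (Fin N → a) (Fin N → b) ℂ}
    (hY : PermInvariant Y) : PermInvariant Yᴴ :=
  fun σ x y => congrArg star (hY σ y x)

theorem PermInvariant.transpose {Y : Matrix (Fin N → a) (Fin N → b) ℂ}
    (hY : PermInvariant Y) : PermInvariant Yᵀ :=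
  fun σ x y => hY σ y x

/-- The permutation operator of a permutation of the tensor factors. -/
def permOp (σ : Equiv.Perm (Fin N)) : Op (Fin N → a) :=
  Matrix.of fun x x' => if x = x' ∘ σ then 1 else 0

theorem comp_eq_iff_eq_comp_symm (σ : Equiv.Perm (Fin N)) (x x' : Fin N → a) :
    x = x' ∘ σ ↔ x' = x ∘ σ.symm := by
  constructor
  · rintro rfl
    ext i
    simp
  · rintro rfl
    ext i
    simp

theorem permOp_apply_symm (σ : Equiv.Perm (Fin N)) (x x' : Fin N → a) :
    permOp σ x x' = if x' = x ∘ σ.symm then 1 else 0 :=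
  if_congr (comp_eq_iff_eq_comp_symm σ x x') rfl rfl

theorem permOp_mul_apply (σ : Equiv.Perm (Fin N)) (Y : Matrix (Fin N → a) (Fin N → b) ℂ) (x y) :
    ((permOp σ : Op (Fin N → a)) * Y) x y = Y (x ∘ σ.symm) y := by
  simp [permOp_apply_symm, Matrix.mul_apply]

theorem mul_permOp_apply (σ : Equiv.Perm (Fin N)) (Y : Matrix (Fin N → a) (Fin N → b) ℂ) (x y) :
    (Y * (permOp σ : Op (Fin N → b))) x y = Y x (y ∘ σ) := by
  simp [permOp, Matrix.mul_apply]

theorem PermInvariant.commute_permOp {X : Op (Fin N → a)} (hX : PermInvariant X)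
    (σ : Equiv.Perm (Fin N)) : Commute X (permOp σ) := by
  ext x y
  rw [permOp_mul_apply, mul_permOp_apply, ← hX σ (x ∘ σ.symm) y]
  congr 1
  ext i
  simp

theorem permInvariant_of_commute_permOp {X : Op (Fin N → a)}
    (hX : ∀ σ : Equiv.Perm (Fin N), Commute X (permOp σ)) : PermInvariant X := by
  intro σ x y
  have h := congrFun (congrFun (hX σ) (x ∘ σ)) y
  rw [mul_permOp_apply, permOp_mul_apply] at h
  rw [h]
  congr 1
  ext i
  simp

/-- The projection onto the symmetric subspace of a tensor power of a bipartite space. -/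
def symProj (N : ℕ) (a b : Type) [Fintype a] [DecidableEq a] [Fintype b] [DecidableEq b] :
    Op ((Fin N → a) × (Fin N → b)) :=
  (Fintype.card (Equiv.Perm (Fin N)) : ℂ)⁻¹ • ∑ σ : Equiv.Perm (Fin N), permOp σ ⊗ₖ permOp σ

theorem symProj_apply (x x' : Fin N → a) (y y' : Fin N → b) :
    symProj N a b (x, y) (x', y') = (Fintype.card (Equiv.Perm (Fin N)) : ℂ)⁻¹ *
      ∑ σ : Equiv.Perm (Fin N), if x = x' ∘ σ ∧ y = y' ∘ σ then 1 else 0 := by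
  simp only [symProj, Matrix.smul_apply, Matrix.sum_apply, Matrix.kroneckerMap_apply, permOp,
    Matrix.of_apply, smul_eq_mul, ite_and, mul_ite, mul_one, mul_zero]
  congr 1
  refine Finset.sum_congr rfl fun σ _ => ?_
  split_ifs <;> rfl

theorem permInvariant_toMat_symProj_col (k : (Fin N → a) × (Fin N → b)) :
    PermInvariant (toMat ((symProj N a b).col k)) := by
  obtain ⟨x', y'⟩ := k
  intro τ x y
  simp only [toMat, Matrix.of_apply, Matrix.col_apply, symProj_apply]
  congr 1
  refine Fintype.sum_equiv (Equiv.mulRight τ⁻¹) _ _ fun σ => ?_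
  have h : ∀ (X : Type) (u v : Fin N → X), u ∘ τ = v ∘ σ ↔ u = v ∘ (σ * τ⁻¹ : Equiv.Perm _) := by
    intro X u v
    rw [eq_comm, ← Equiv.comp_symm_eq, eq_comm]
    rfl
  exact if_congr (and_congr (h _ _ _) (h _ _ _)) rfl rfl

theorem isHermitian_symProj : (symProj N a b).IsHermitian := by
  ext ⟨x, y⟩ ⟨x', y'⟩
  rw [Matrix.conjTranspose_apply, symProj_apply, symProj_apply, star_mul', star_inv₀,
    star_natCast, star_sum]
  congr 1
  refine Fintype.sum_equiv (Equiv.inv _) _ _ fun σ => ?_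
  rw [apply_ite star, star_one, star_zero]
  exact if_congr (and_congr (comp_eq_iff_eq_comp_symm _ _ _) (comp_eq_iff_eq_comp_symm _ _ _))
    rfl rfl

theorem symProj_mulVec_toVec {Y : Matrix (Fin N → a) (Fin N → b) ℂ} (hY : PermInvariant Y) :
    symProj N a b *ᵥ toVec Y = toVec Y := by
  have h : ∀ σ : Equiv.Perm (Fin N),
      ((permOp σ : Op (Fin N → a)) ⊗ₖ (permOp σ : Op (Fin N → b))) *ᵥ toVec Y = toVec Y := by
    intro σ
    ext ⟨x, y⟩
    have := hY σ.symm x y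
    simp only [Matrix.mulVec, dotProduct, Fintype.sum_prod_type, Matrix.kroneckerMap_apply, toVec,
      permOp_apply_symm]
    simpa using this
  rw [symProj, Matrix.smul_mulVec, Matrix.sum_mulVec, Finset.sum_congr rfl fun σ _ => h σ,
    Finset.sum_const, Finset.card_univ, ← Nat.cast_smul_eq_nsmul ℂ, smul_smul,
    inv_mul_cancel₀ (Nat.cast_ne_zero.mpr Fintype.card_ne_zero), one_smul]

theorem symProj_mul_self : symProj N a b * symProj N a b = symProj N a b := by
  refine Matrix.ext_of_mulVec_single fun k => ?_
  rw [← Matrix.mulVec_mulVec, Matrix.mulVec_single_one]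
  exact symProj_mulVec_toVec (permInvariant_toMat_symProj_col k)

theorem commute_symProj {r : Op (Fin N → b)} (hr : PermInvariant r) :
    Commute (symProj N a b) ((1 : Op (Fin N → a)) ⊗ₖ r) := by
  refine Commute.smul_left (Commute.sum_left _ _ _ fun σ _ => ?_) _
  rw [Commute, SemiconjBy, ← Matrix.mul_kronecker_mul, ← Matrix.mul_kronecker_mul,
    (hr.commute_permOp σ).eq, Matrix.one_mul, Matrix.mul_one]

theorem permInvariant_partialTrace_symProj_mul (T : Op ((Fin N → a) × (Fin N → b))) :
    PermInvariant (partialTrace (symProj N a b * T * symProj N a b)) := by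
  have hleft : ∀ (S : Op ((Fin N → a) × (Fin N → b))) (σ : Equiv.Perm (Fin N)) x y k,
      (symProj N a b * S) (x ∘ σ, y ∘ σ) k = (symProj N a b * S) (x, y) k := by
    intro S σ x y k
    simp only [Matrix.mul_apply]
    exact Finset.sum_congr rfl fun j _ => by
      rw [show symProj N a b (x ∘ σ, y ∘ σ) j = symProj N a b (x, y) j from
        permInvariant_toMat_symProj_col j σ x y]
  have hright : ∀ (S : Op ((Fin N → a) × (Fin N → b))) (σ : Equiv.Perm (Fin N)) x y k,
      (S * symProj N a b) k (x ∘ σ, y ∘ σ) = (S * symProj N a b) k (x, y) := by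
    intro S σ x y k
    have h := hleft Sᴴ σ x y k
    rw [← isHermitian_symProj.eq, ← Matrix.conjTranspose_mul, Matrix.conjTranspose_apply,
      Matrix.conjTranspose_apply] at h
    exact star_injective h
  intro σ x x'
  rw [partialTrace_apply, partialTrace_apply, ← sum_comp_perm σ]
  refine Finset.sum_congr rfl fun y _ => ?_
  rw [hright, Matrix.mul_assoc, hleft]

theorem commute_partialTrace_symProj {X : Op (Fin N → a)} (hX : PermInvariant X) :
    Commute (partialTrace (symProj N a b)) X := by
  have h : partialTrace (symProj N a b) = (Fintype.card (Equiv.Perm (Fin N)) : ℂ)⁻¹ •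
      ∑ σ : Equiv.Perm (Fin N), (permOp σ : Op (Fin N → b)).trace • permOp σ := by
    ext x x'
    simp only [partialTrace_apply, symProj, Matrix.smul_apply, Matrix.sum_apply,
      Matrix.kroneckerMap_apply, ← Finset.smul_sum]
    rw [Finset.sum_comm]
    simp only [Matrix.trace, Matrix.diag, smul_eq_mul, Finset.mul_sum, mul_comm]
  rw [h]
  exact ((Commute.sum_right _ _ _ fun σ _ => (hX.commute_permOp σ).smul_right _).smul_right _).symm

/-- On the symmetric subspace, an effect that commutes with the permutation invariant operators of
the second party acts as an effect of the first party. -/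
theorem exists_effect_mul_eq {T : Op ((Fin N → a) × (Fin N → b))} (hT : IsEffect T)
    (hcomm : ∀ r : Op (Fin N → b), PermInvariant r → Commute T ((1 : Op (Fin N → a)) ⊗ₖ r)) :
    ∃ L : Op (Fin N → a), IsEffect L ∧ ∀ Y : Matrix (Fin N → a) (Fin N → b) ℂ, PermInvariant Y →
      (L ⊗ₖ (1 : Op (Fin N → b))) *ᵥ toVec Y = symProj N a b *ᵥ (T *ᵥ toVec Y) := by
  set P := symProj N a b with hP
  have hPH : Pᴴ = P := isHermitian_symProj.eq
  have hPP : P * P = P := symProj_mul_self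
  set T' := P * T * P with hT'
  set X := partialTrace T' with hX
  set C := partialTrace P with hC
  have hT'psd : T'.PosSemidef := by
    have := hT.1.mul_mul_conjTranspose_same P
    rwa [hPH] at this
  have hPT'psd : (P - T').PosSemidef := by
    have := hT.2.mul_mul_conjTranspose_same P
    rwa [hPH, Matrix.mul_sub, Matrix.sub_mul, Matrix.mul_one, hPP] at this
  have hPpsd : P.PosSemidef := by
    have := Matrix.posSemidef_self_mul_conjTranspose P
    rwa [hPH, hPP] at this
  have hCpsd : C.PosSemidef := posSemidef_partialTrace hPpsd
  have hXpsd : X.PosSemidef := posSemidef_partialTrace hT'psd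
  have hCXpsd : (C - X).PosSemidef := by
    rw [hC, hX, ← partialTrace_sub]
    exact posSemidef_partialTrace hPT'psd
  have hXinv : PermInvariant X := permInvariant_partialTrace_symProj_mul T
  have hCinv : PermInvariant C := by
    have := permInvariant_partialTrace_symProj_mul (1 : Op ((Fin N → a) × (Fin N → b)))
    rwa [Matrix.mul_one, ← hP, hPP] at this
  have hCX : Commute C X := commute_partialTrace_symProj hXinv
  have hcol : ∀ k, PermInvariant (toMat (P.col k)) := permInvariant_toMat_symProj_col
  have hCsum : C = ∑ k, toMat (P.col k) * (toMat (P.col k))ᴴ := by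
    rw [← partialTrace_mul_conjTranspose, hPH, hPP]
  have hcomm' : ∀ r : Op (Fin N → b), PermInvariant r →
      Commute T' ((1 : Op (Fin N → a)) ⊗ₖ r) := fun r hr =>
    ((commute_symProj hr).mul_left (hcomm r hr)).mul_left (commute_symProj hr)
  have hXW : ∀ W : Matrix (Fin N → a) (Fin N → b) ℂ, PermInvariant W →
      X * W = toMat (T' *ᵥ toVec (C * W)) := by
    intro W hW
    have h1 : X = ∑ k, toMat (T' *ᵥ P.col k) * (toMat (P.col k))ᴴ := by
      have : T' = T' * P * Pᴴ := by
        rw [hPH, Matrix.mul_assoc, hPP, hT', Matrix.mul_assoc (P * T), hPP]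
      rw [hX, this, partialTrace_mul_conjTranspose, ← this]
      rfl
    rw [h1, hCsum, Matrix.sum_mul, Matrix.sum_mul, toMat_mulVec_sum]
    refine Finset.sum_congr rfl fun k _ => ?_
    rw [Matrix.mul_assoc, Matrix.mul_assoc,
      toMat_mulVec_mul (hcomm' _ ((hcol k).conjTranspose.mul hW).transpose)]
    rfl
  obtain ⟨S, hS, hScomm, hCSC⟩ := exists_sqrt_pseudoInverse hCpsd
  have hSC : Commute S C := hScomm C (Commute.refl C)
  have hSX : Commute S X := hScomm X hCX
  have hSinv : PermInvariant S := permInvariant_of_commute_permOp fun σ =>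
    hScomm _ (hCinv.commute_permOp σ)
  have hQC : (1 - S * C * S) * C = 0 := by
    rw [Matrix.sub_mul, Matrix.one_mul, hSC.eq, Matrix.mul_assoc C, hCSC, sub_self]
  have hQH : (1 - S * C * S)ᴴ = 1 - S * C * S := by
    rw [Matrix.conjTranspose_sub, Matrix.conjTranspose_one, Matrix.conjTranspose_mul,
      Matrix.conjTranspose_mul, hS.eq, hCpsd.isHermitian.eq, Matrix.mul_assoc]
  have hQpsd : (1 - S * C * S).PosSemidef := by
    have h := Matrix.posSemidef_self_mul_conjTranspose (1 - S * C * S)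
    have hE : (1 - S * C * S) * (S * C * S) = 0 := by
      rw [hSC.eq, Matrix.mul_assoc C, ← Matrix.mul_assoc _ C, ← Matrix.mul_assoc C, ← hSC.eq, hQC,
        Matrix.zero_mul]
    rwa [hQH, Matrix.mul_sub, Matrix.mul_one, hE, sub_zero] at h
  refine ⟨S * X * S, ⟨?_, ?_⟩, fun Y hY => ?_⟩
  · have := hXpsd.mul_mul_conjTranspose_same S
    rwa [hS.eq] at this
  · have := hCXpsd.mul_mul_conjTranspose_same S
    rw [hS.eq, Matrix.mul_sub, Matrix.sub_mul] at this
    have h2 := hQpsd.add this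
    rwa [sub_add_sub_cancel] at h2
  · have hQcol : ∀ k, (1 - S * C * S) * toMat (P.col k) = 0 := by
      have h : ∑ k, ((1 - S * C * S) * toMat (P.col k)) *
          ((1 - S * C * S) * toMat (P.col k))ᴴ = 0 := by
        generalize 1 - S * C * S = Q at hQC ⊢
        simp only [Matrix.conjTranspose_mul, Matrix.mul_assoc, ← Matrix.mul_sum]
        simp only [← Matrix.mul_assoc (toMat _), ← Matrix.sum_mul, ← hCsum]
        rw [← Matrix.mul_assoc, hQC, Matrix.zero_mul]
      intro k
      have h2 := congrArg Matrix.trace h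
      rw [Matrix.trace_sum, Matrix.trace_zero, Finset.sum_eq_zero_iff_of_nonneg fun k _ =>
        (Matrix.posSemidef_self_mul_conjTranspose _).trace_nonneg] at h2
      exact Matrix.trace_mul_conjTranspose_self_eq_zero_iff.mp (h2 k (Finset.mem_univ k))
    have hYsum : Y = ∑ k, toVec Y k • toMat (P.col k) := by
      have h := congrArg toMat (symProj_mulVec_toVec hY)
      rw [← hP] at h
      ext x y
      have h2 := congrFun (congrFun h x) y
      change _ = Y x y at h2
      rw [← h2]
      simp [toMat, Matrix.mulVec, dotProduct, Matrix.sum_apply, mul_comm]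
    have hQY : C * (S * S * Y) = Y := by
      have h : (1 - S * C * S) * Y = 0 := by
        rw [hYsum, Matrix.mul_sum]
        exact Finset.sum_eq_zero fun k _ => by rw [Matrix.mul_smul, hQcol, smul_zero]
      rw [Matrix.sub_mul, Matrix.one_mul, sub_eq_zero, hSC.eq] at h
      conv_rhs => rw [h]
      simp only [Matrix.mul_assoc]
    have h : S * X * S * Y = toMat (T' *ᵥ toVec Y) := by
      rw [hSX.eq, Matrix.mul_assoc X, Matrix.mul_assoc X, hXW _ ((hSinv.mul hSinv).mul hY), hQY]
    rw [kronecker_one_mulVec_toVec, h, hT', ← Matrix.mulVec_mulVec, ← Matrix.mulVec_mulVec,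
      symProj_mulVec_toVec hY]
    rfl

end PermMatrix

section LocalEffect

variable {N : ℕ} {a b : Type} [Fintype a] [DecidableEq a] [Fintype b] [DecidableEq b]

theorem commute_one_kronecker_iff {α β : Type} [Fintype α] [DecidableEq α] [Fintype β]
    [DecidableEq β] {T : Op (α × β)} {r : Op β} :
    Commute T ((1 : Op α) ⊗ₖ r) ↔
      ∀ x x', Commute (Matrix.of fun y y' => T (x, y) (x', y')) r := by
  have h1 : ∀ x y x' y', (T * ((1 : Op α) ⊗ₖ r)) (x, y) (x', y')
      = ((Matrix.of fun y y' => T (x, y) (x', y')) * r) y y' := by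
    intro x y x' y'
    simp [Matrix.mul_apply, Fintype.sum_prod_type, Matrix.kroneckerMap_apply, Matrix.one_apply]
  have h2 : ∀ x y x' y', (((1 : Op α) ⊗ₖ r) * T) (x, y) (x', y')
      = (r * (Matrix.of fun y y' => T (x, y) (x', y'))) y y' := by
    intro x y x' y'
    simp [Matrix.mul_apply, Fintype.sum_prod_type, Matrix.kroneckerMap_apply, Matrix.one_apply]
  constructor
  · intro h x x'
    ext y y'
    rw [← h1, ← h2, h.eq]
  · intro h
    ext ⟨x, y⟩ ⟨x', y'⟩
    rw [h1, h2, (h x x').eq]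

theorem tensorPower_one_kronecker (r : Op b) :
    tensorPower N ((1 : Op a) ⊗ₖ r) = localProd (1 : Op (Fin N → a)) (tensorPower N r) := by
  have h := piKron_one (κ := Fin N) (n := a)
  ext x y
  rw [← h]
  exact Finset.prod_mul_distrib (s := Finset.univ) (f := fun i => (1 : Op a) (x i).1 (y i).1)
    (g := fun i => r (x i).2 (y i).2)

theorem trace_mul_vecMulVec_star {n : Type} [Fintype n] (A : Op n) (v : n → ℂ) :
    (A * Matrix.vecMulVec v (star v)).trace = star v ⬝ᵥ (A *ᵥ v) := by
  rw [Matrix.mul_vecMulVec, Matrix.trace_vecMulVec, dotProduct_comm]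

theorem tensorPower_vecMulVec_star {n : Type} (ψ : n → ℂ) :
    tensorPower N (Matrix.vecMulVec ψ (star ψ))
      = Matrix.vecMulVec (fun x => ∏ i, ψ (x i)) (star fun x : Fin N → n => ∏ i, ψ (x i)) := by
  ext x y
  simp [tensorPower, Matrix.vecMulVec_apply, Finset.prod_mul_distrib]

/-- For tensor powers of pure states, an effect that is invariant under unitaries of the second
party can be replaced by an effect of the first party. -/
theorem exists_local_effect {T : Op (Fin N → a × b)} (hT : IsEffect T)
    (hcomm : ∀ U ∈ Matrix.unitaryGroup b ℂ, Commute T (tensorPower N ((1 : Op a) ⊗ₖ U))) :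
    ∃ L : Op (Fin N → a), IsEffect L ∧ ∀ ψ : a × b → ℂ,
      (localProd L 1 * tensorPower N (Matrix.vecMulVec ψ (star ψ))).trace
        = (T * tensorPower N (Matrix.vecMulVec ψ (star ψ))).trace := by
  let e := Equiv.arrowProdEquivProdArrow (Fin N) (fun _ => a) (fun _ => b)
  have hsub : ∀ A : Op ((Fin N → a) × (Fin N → b)),
      (A.submatrix e e).submatrix e.symm e.symm = A := fun A => by
    ext i j
    simp
  have hcomm' : ∀ r : Op (Fin N → b), PermInvariant r →
      Commute (T.submatrix e.symm e.symm) ((1 : Op (Fin N → a)) ⊗ₖ r) := by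
    intro r hr
    rw [commute_one_kronecker_iff]
    intro x x'
    refine commute_of_commute_tensorPower (fun U hU => ?_) hr
    refine commute_one_kronecker_iff.mp ?_ x x'
    have h := hcomm U hU
    rw [tensorPower_one_kronecker] at h
    rw [← hsub ((1 : Op (Fin N → a)) ⊗ₖ tensorPower N U), Commute, SemiconjBy,
      Matrix.submatrix_mul_equiv, Matrix.submatrix_mul_equiv]
    exact congrArg (fun A : Op (Fin N → a × b) => A.submatrix e.symm e.symm) h.eq
  obtain ⟨L, hL, hLT⟩ := exists_effect_mul_eq (hT.submatrix_equiv e.symm) hcomm'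
  refine ⟨L, hL, fun ψ => ?_⟩
  set Ψ : (Fin N → a × b) → ℂ := fun x => ∏ i, ψ (x i) with hΨ
  let Y : Matrix (Fin N → a) (Fin N → b) ℂ := Matrix.of fun x y => ∏ i, ψ (x i, y i)
  have hY : PermInvariant Y := fun σ x y => Equiv.prod_comp σ fun i => ψ (x i, y i)
  have hΨY : Ψ = toVec Y ∘ e := rfl
  have htr : ∀ A : Op ((Fin N → a) × (Fin N → b)),
      star Ψ ⬝ᵥ (A.submatrix e e *ᵥ Ψ) = star (toVec Y) ⬝ᵥ (A *ᵥ toVec Y) := by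
    intro A
    have h : A.submatrix e e *ᵥ Ψ = (A *ᵥ toVec Y) ∘ e := by
      rw [hΨY, Matrix.submatrix_mulVec_equiv]
      simp [Function.comp_assoc]
    rw [h, hΨY]
    exact Fintype.sum_equiv e _ _ fun _ => rfl
  have hT' : T = (T.submatrix e.symm e.symm).submatrix e e := by
    ext i j
    simp
  rw [tensorPower_vecMulVec_star, trace_mul_vecMulVec_star, trace_mul_vecMulVec_star, ← hΨ, hT',
    htr]
  change star Ψ ⬝ᵥ ((L ⊗ₖ (1 : Op (Fin N → b))).submatrix e e *ᵥ Ψ) = _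
  rw [htr, hLT Y hY, Matrix.dotProduct_mulVec]
  congr 1
  rw [← isHermitian_symProj.eq, ← Matrix.star_mulVec, symProj_mulVec_toVec hY]

end LocalEffect

section Twirl

variable {n : Type} [Fintype n] [DecidableEq n] {N : ℕ}

theorem isClosed_setOf_posSemidef : IsClosed {A : Op n | A.PosSemidef} := by
  simp only [Matrix.posSemidef_iff_dotProduct_mulVec, Set.ofPred_and, Set.ofPred_forall]
  refine IsClosed.inter (isClosed_eq (by fun_prop) continuous_id) ?_
  refine isClosed_iInter fun x => isClosed_le continuous_const ?_
  fun_prop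

theorem isClosed_setOf_isTester (P : Property n) (c s : ℝ) :
    IsClosed {T : Op (Fin N → n) | IsTester P c s N T} := by
  have htr : ∀ ρ : Op n, Continuous fun T : Op (Fin N → n) => (T * tensorPower N ρ).trace.re :=
    fun ρ => Complex.continuous_re.comp
      ((continuous_id.matrix_mul continuous_const).matrix_trace)
  simp only [IsTester, IsEffect, Set.ofPred_and, Set.ofPred_forall]
  refine IsClosed.inter (isClosed_setOf_posSemidef.inter
    (isClosed_setOf_posSemidef.preimage (continuous_const.sub continuous_id)))
    (IsClosed.inter ?_ ?_)
  · exact isClosed_iInter fun ρ => isClosed_iInter fun _ => isClosed_le continuous_const (htr ρ)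
  · exact isClosed_iInter fun ρ => isClosed_iInter fun _ => isClosed_le (htr ρ) continuous_const

theorem IsTester.midpoint {P : Property n} {c s : ℝ} {S T : Op (Fin N → n)}
    (hS : IsTester P c s N S) (hT : IsTester P c s N T) :
    IsTester P c s N ((2⁻¹ : ℂ) • (S + T)) := by
  have h2 : (0 : ℂ) ≤ 2⁻¹ := by positivity
  have htr : ∀ ρ : Op n, ((2⁻¹ : ℂ) • (S + T) * tensorPower N ρ).trace.re
      = 2⁻¹ * ((S * tensorPower N ρ).trace.re + (T * tensorPower N ρ).trace.re) := by
    intro ρ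
    rw [Matrix.smul_mul, Matrix.trace_smul, Matrix.add_mul, Matrix.trace_add, smul_eq_mul,
      show (2⁻¹ : ℂ) = ((2⁻¹ : ℝ) : ℂ) by push_cast; rfl, Complex.re_ofReal_mul, Complex.add_re]
  refine ⟨⟨(hS.1.1.add hT.1.1).smul h2, ?_⟩, fun ρ hρ => ?_, fun ρ hρ => ?_⟩
  · have h := (hS.1.2.add hT.1.2).smul h2
    have h' : (2⁻¹ : ℂ) • (1 - S + (1 - T)) = 1 - (2⁻¹ : ℂ) • (S + T) := by
      ext i j
      simp only [Matrix.smul_apply, Matrix.add_apply, Matrix.sub_apply, smul_eq_mul]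
      ring
    rwa [h'] at h
  · rw [htr]
    linarith [hS.2.1 ρ hρ, hT.2.1 ρ hρ]
  · rw [htr]
    linarith [hS.2.2 ρ hρ, hT.2.2 ρ hρ]

variable {a b : Type} [Fintype a] [DecidableEq a] [Fintype b] [DecidableEq b]

theorem conjTranspose_one_kronecker (U : Op b) :
    ((1 : Op a) ⊗ₖ U)ᴴ = (1 : Op a) ⊗ₖ Uᴴ := by
  rw [Matrix.conjTranspose_kronecker, Matrix.conjTranspose_one]

theorem tensorPower_one_kronecker_mem_unitary {U : Op b} (hU : U ∈ Matrix.unitaryGroup b ℂ) :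
    (tensorPower N ((1 : Op a) ⊗ₖ U))ᴴ * tensorPower N ((1 : Op a) ⊗ₖ U) = 1 := by
  have h : Uᴴ * U = 1 := Matrix.mem_unitaryGroup_iff'.mp hU
  have h1 : (tensorPower N ((1 : Op a) ⊗ₖ U))ᴴ = tensorPower N ((1 : Op a) ⊗ₖ Uᴴ) := by
    rw [← conjTranspose_one_kronecker]
    exact conjTranspose_piKron _
  rw [h1, ← tensorPower_mul, ← Matrix.mul_kronecker_mul, Matrix.one_mul, h,
    Matrix.one_kronecker_one]
  exact piKron_one

theorem IsTester.conj {P : Property (a × b)} (hinv : UnitarilyInvariantOnB P) {c s : ℝ}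
    {T : Op (Fin N → a × b)} (hT : IsTester P c s N T) {U : Op b}
    (hU : U ∈ Matrix.unitaryGroup b ℂ) :
    IsTester P c s N (tensorPower N ((1 : Op a) ⊗ₖ U) * T * (tensorPower N ((1 : Op a) ⊗ₖ U))ᴴ) := by
  set V := tensorPower N ((1 : Op a) ⊗ₖ U) with hV
  have hVV : V * Vᴴ = 1 := mul_eq_one_comm.mp (tensorPower_one_kronecker_mem_unitary hU)
  have hVs : Vᴴ = tensorPower N ((1 : Op a) ⊗ₖ Uᴴ) := by
    rw [← conjTranspose_one_kronecker]
    exact conjTranspose_piKron _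
  have htr : ∀ ρ : Op (a × b), (V * T * Vᴴ * tensorPower N ρ).trace
      = (T * tensorPower N (((1 : Op a) ⊗ₖ Uᴴ) * ρ * ((1 : Op a) ⊗ₖ Uᴴ)ᴴ)).trace := by
    intro ρ
    rw [conjTranspose_one_kronecker, Matrix.conjTranspose_conjTranspose, tensorPower_mul,
      tensorPower_mul, ← hVs, ← hV, Matrix.mul_assoc, Matrix.mul_assoc, Matrix.trace_mul_comm]
    simp only [Matrix.mul_assoc]
  have hU' : Uᴴ ∈ Matrix.unitaryGroup b ℂ := Unitary.star_mem hU
  refine ⟨⟨hT.1.1.mul_mul_conjTranspose_same V, ?_⟩, fun ρ hρ => ?_, fun ρ hρ => ?_⟩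
  · have h := hT.1.2.mul_mul_conjTranspose_same V
    rwa [Matrix.mul_sub, Matrix.sub_mul, Matrix.mul_one, hVV] at h
  · rw [htr]
    exact hT.2.1 _ ((hinv _ hU').1 ρ hρ)
  · rw [htr]
    exact hT.2.2 _ ((hinv _ hU').2 ρ hρ)

/-- A tester of least Frobenius norm is invariant under the symmetries of the property. -/
theorem exists_invariant_isTester {P : Property (a × b)} (hinv : UnitarilyInvariantOnB P) {c s : ℝ}
    (hP : ∃ T : Op (Fin N → a × b), IsTester P c s N T) :
    ∃ T : Op (Fin N → a × b), IsTester P c s N T ∧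
      ∀ U ∈ Matrix.unitaryGroup b ℂ, Commute T (tensorPower N ((1 : Op a) ⊗ₖ U)) := by
  let X := Fin N → a × b
  let toOp : EuclideanSpace ℂ (X × X) → Op X := fun v => Matrix.of fun i j => v (i, j)
  let ofOp : Op X → EuclideanSpace ℂ (X × X) := fun A => WithLp.toLp 2 fun p => A p.1 p.2
  have hnorm : ∀ A : Op X, ((‖ofOp A‖ ^ 2 : ℝ) : ℂ) = (A * Aᴴ).trace := by
    intro A
    rw [EuclideanSpace.norm_sq_eq, Fintype.sum_prod_type]
    simp [ofOp, Matrix.trace, Matrix.mul_apply, Complex.mul_conj, Complex.normSq_eq_norm_sq]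
  have hclosed : IsClosed {v | IsTester P c s N (toOp v)} := by
    refine (isClosed_setOf_isTester P c s).preimage ?_
    exact continuous_matrix fun i j => by fun_prop
  obtain ⟨T₀, hT₀⟩ := hP
  obtain ⟨v, hv, hmin⟩ := hclosed.exists_infDist_eq_dist ⟨ofOp T₀, hT₀⟩ 0
  have hmin' : ∀ w, IsTester P c s N (toOp w) → ‖v‖ ≤ ‖w‖ := by
    intro w hw
    rw [← dist_zero_left v, ← dist_zero_left w, ← hmin]
    exact Metric.infDist_le_dist_of_mem hw
  refine ⟨toOp v, hv, fun U hU => ?_⟩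
  set V := tensorPower N ((1 : Op a) ⊗ₖ U) with hV
  have hVV : Vᴴ * V = 1 := tensorPower_one_kronecker_mem_unitary hU
  set w := ofOp (V * toOp v * Vᴴ) with hw
  have hwT : IsTester P c s N (toOp w) := hv.conj hinv hU
  have hnw : ‖v‖ = ‖w‖ := by
    have h : ((‖w‖ ^ 2 : ℝ) : ℂ) = ((‖v‖ ^ 2 : ℝ) : ℂ) := by
      rw [hw, hnorm, show v = ofOp (toOp v) from rfl, hnorm]
      rw [show toOp (ofOp (toOp v)) = toOp v from rfl]
      simp only [Matrix.conjTranspose_mul, Matrix.conjTranspose_conjTranspose]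
      rw [Matrix.trace_mul_comm]
      simp only [← Matrix.mul_assoc]
      rw [Matrix.mul_assoc V, Matrix.mul_assoc V, Matrix.trace_mul_comm]
      simp only [Matrix.mul_assoc, hVV, Matrix.mul_one]
      rw [← Matrix.mul_assoc Vᴴ, hVV, Matrix.one_mul, Matrix.trace_mul_comm]
    have h2 : ‖w‖ ^ 2 = ‖v‖ ^ 2 := Complex.ofReal_injective h
    exact ((sq_eq_sq₀ (norm_nonneg _) (norm_nonneg _)).mp h2).symm
  have hvw : v = w := by
    refine eq_of_norm_eq_of_norm_add_eq hnw (le_antisymm (norm_add_le _ _) ?_)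
    have hm : IsTester P c s N (toOp ((2⁻¹ : ℂ) • (v + w))) := hv.midpoint hwT
    have h := hmin' _ hm
    rw [norm_smul, norm_inv, Complex.norm_ofNat] at h
    linarith
  have hfix : V * toOp v * Vᴴ = toOp v := by
    change toOp w = _
    rw [← hvw]
  calc toOp v * V = V * toOp v * Vᴴ * V := by rw [hfix]
    _ = V * toOp v := by rw [Matrix.mul_assoc, hVV, Matrix.mul_one]

end Twirl

section States

variable {n : Type} [Fintype n] [DecidableEq n] {N : ℕ}

theorem IsPure.isDensity {ρ : Op n} (h : IsPure ρ) : IsDensity ρ := by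
  obtain ⟨ψ, hψ, rfl⟩ := h
  exact ⟨Matrix.posSemidef_vecMulVec_self_star ψ, by
    rw [Matrix.trace_vecMulVec, dotProduct_comm, hψ]⟩

theorem IsPure.trace_mul_self {ρ : Op n} (h : IsPure ρ) : (ρ * ρ).trace = 1 := by
  have htr := h.isDensity.2
  obtain ⟨ψ, hψ, rfl⟩ := h
  rw [Matrix.vecMulVec_mul_vecMulVec, hψ]
  simpa using htr

theorem IsDensity.tensorPower {ρ : Op n} (hρ : IsDensity ρ) :
    IsDensity (StateTesting.tensorPower N ρ) := by
  refine ⟨posSemidef_piKron fun _ => hρ.1, ?_⟩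
  have h := trace_piKron fun _ : Fin N => ρ
  rw [hρ.2, Finset.prod_const_one] at h
  exact h

/-- A state dominates its top eigenvalue times the corresponding pure state, and its purity is at
most its top eigenvalue. -/
theorem IsDensity.exists_top_eigenvector {ρ : Op n} (hρ : IsDensity ρ) :
    ∃ (p : ℝ) (ψ : n → ℂ), 0 ≤ p ∧ p ≤ 1 ∧ star ψ ⬝ᵥ ψ = 1 ∧
      (ρ - (p : ℂ) • Matrix.vecMulVec ψ (star ψ)).PosSemidef ∧ (ρ * ρ).trace.re ≤ p := by
  have hH := hρ.1.isHermitian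
  have hne : Nonempty n := by
    by_contra h
    rw [not_nonempty_iff] at h
    have := hρ.2
    simp [Matrix.trace] at this
  obtain ⟨i, hi⟩ := Finite.exists_max hH.eigenvalues
  set ev := hH.eigenvalues with hev
  set U : Op n := hH.eigenvectorUnitary.1 with hU
  have hUU : Uᴴ * U = 1 := Matrix.mem_unitaryGroup_iff'.mp hH.eigenvectorUnitary.2
  have hUU' : U * Uᴴ = 1 := mul_eq_one_comm.mp hUU
  have hspec : ρ = U * Matrix.diagonal (fun j => (ev j : ℂ)) * Uᴴ := hH.spectral_theorem
  have hpos : ∀ j, 0 ≤ ev j := hρ.1.eigenvalues_nonneg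
  have hsum : ∑ j, ev j = 1 := by
    have h := hH.trace_eq_sum_eigenvalues
    rw [hρ.2] at h
    refine Complex.ofReal_injective ?_
    rw [Complex.ofReal_sum, Complex.ofReal_one]
    exact h.symm
  refine ⟨ev i, U *ᵥ Pi.single i 1, hpos i, ?_, ?_, ?_, ?_⟩
  · rw [← hsum]
    exact Finset.single_le_sum (fun j _ => hpos j) (Finset.mem_univ i)
  · rw [Matrix.star_mulVec, ← Matrix.dotProduct_mulVec, Matrix.mulVec_mulVec, hUU,
      Matrix.one_mulVec]
    simp
  · have h : ρ - (ev i : ℂ) • Matrix.vecMulVec (U *ᵥ Pi.single i 1) (star (U *ᵥ Pi.single i 1))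
        = U * Matrix.diagonal (fun j => if j = i then 0 else (ev j : ℂ)) * Uᴴ := by
      have h1 : Matrix.diagonal (fun j => if j = i then 0 else (ev j : ℂ))
          = Matrix.diagonal (fun j => (ev j : ℂ))
            - (ev i : ℂ) • Matrix.vecMulVec (Pi.single i 1) (star (Pi.single i (1 : ℂ))) := by
        ext j k
        by_cases hjk : j = k
        · subst hjk
          by_cases hji : j = i
          · subst hji
            simp [Matrix.vecMulVec_apply]
          · simp [Matrix.vecMulVec_apply, hji]
        · by_cases hji : j = i
          · subst hji
            simp [Matrix.vecMulVec_apply, hjk]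
          · simp [Matrix.vecMulVec_apply, hjk, hji]
      rw [h1, Matrix.mul_sub, Matrix.sub_mul, ← hspec, Matrix.mul_smul, Matrix.smul_mul,
        Matrix.mul_vecMulVec, Matrix.vecMulVec_mul, Matrix.star_mulVec]
    rw [h]
    refine (Matrix.PosSemidef.diagonal fun j => ?_).mul_mul_conjTranspose_same U
    by_cases hj : j = i
    · simp [hj]
    · simpa [hj] using hpos j
  · have h : ((ev i : ℂ) • (1 : Op n) - ρ).PosSemidef := by
      have h1 : (ev i : ℂ) • (1 : Op n) - ρ
          = U * Matrix.diagonal (fun j => ((ev i - ev j : ℝ) : ℂ)) * Uᴴ := by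
        have h2 : Matrix.diagonal (fun j => ((ev i - ev j : ℝ) : ℂ))
            = (ev i : ℂ) • (1 : Op n) - Matrix.diagonal (fun j => (ev j : ℂ)) := by
          rw [Matrix.smul_one_eq_diagonal, Matrix.diagonal_sub]
          simp
        rw [h2, Matrix.mul_sub, Matrix.sub_mul, ← hspec, Matrix.mul_smul, Matrix.smul_mul,
          Matrix.mul_one, hUU']
      rw [h1]
      refine (Matrix.PosSemidef.diagonal fun j => ?_).mul_mul_conjTranspose_same U
      simpa using hi j
    have h3 := trace_mul_re_nonneg h hρ.1
    rw [Matrix.sub_mul, Matrix.smul_mul, Matrix.one_mul, Matrix.trace_sub, Matrix.trace_smul,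
      hρ.2, smul_eq_mul, mul_one, Complex.sub_re, Complex.ofReal_re] at h3
    linarith

theorem tensorPower_smul (z : ℂ) (ρ : Op n) : tensorPower N (z • ρ) = z ^ N • tensorPower N ρ := by
  ext x y
  simp [tensorPower, Finset.prod_mul_distrib]

/-- If two effects agree on tensor powers of pure states, then on the tensor power of a state they
differ at most by the weight outside of the top eigenvector. -/
theorem trace_mul_tensorPower_le {E T : Op (Fin N → n)} (hE : IsEffect E) (hT : T.PosSemidef)
    (hET : ∀ ψ : n → ℂ, (E * tensorPower N (Matrix.vecMulVec ψ (star ψ))).trace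
        = (T * tensorPower N (Matrix.vecMulVec ψ (star ψ))).trace)
    {ρ : Op n} (hρ : IsDensity ρ) {p : ℝ} {ψ : n → ℂ} (hp : 0 ≤ p) (hψ : star ψ ⬝ᵥ ψ = 1)
    (hpψ : (ρ - (p : ℂ) • Matrix.vecMulVec ψ (star ψ)).PosSemidef) :
    (E * tensorPower N ρ).trace.re ≤ (T * tensorPower N ρ).trace.re + N * (1 - p) := by
  set σ := Matrix.vecMulVec ψ (star ψ) with hσ
  have hσd : IsDensity σ := IsPure.isDensity ⟨ψ, hψ, rfl⟩
  have hpσ : ((p : ℂ) • σ).PosSemidef := hσd.1.smul (by exact_mod_cast hp)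
  have hdiff : (tensorPower N ρ - (p : ℂ) ^ N • tensorPower N σ).PosSemidef := by
    have h := posSemidef_piKron_add_sub (κ := Fin N) (fun _ => hpσ) (fun _ => hpψ)
    simp only [add_sub_cancel] at h
    rw [← tensorPower_smul]
    exact h
  have hre : ∀ A : Op (Fin N → n), ((A * (tensorPower N ρ - (p : ℂ) ^ N • tensorPower N σ)).trace).re
      = (A * tensorPower N ρ).trace.re - p ^ N * (A * tensorPower N σ).trace.re := by
    intro A
    rw [Matrix.mul_sub, Matrix.mul_smul, Matrix.trace_sub, Matrix.trace_smul, Complex.sub_re,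
      smul_eq_mul, ← Complex.ofReal_pow, Complex.re_ofReal_mul]
  have h1 := hE.trace_mul_re_le hdiff
  have h2 := trace_mul_re_nonneg hT hdiff
  have h3 := hre 1
  rw [Matrix.one_mul, Matrix.one_mul, Matrix.one_mul, hρ.tensorPower.2, hσd.tensorPower.2] at h3
  rw [h3, hre, hET] at h1
  rw [hre] at h2
  have h4 := one_add_mul_le_pow (a := p - 1) (by linarith) N
  rw [add_sub_cancel] at h4
  simp only [Complex.one_re] at h1
  linarith

end States

section SwapTest

variable {n : Type} [Fintype n] [DecidableEq n]

/-- The projection onto the symmetric subspace of two copies. -/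
def swapTest (n : Type) [Fintype n] [DecidableEq n] : Op (Fin 2 → n) :=
  (2⁻¹ : ℂ) • (1 + permOp (Equiv.swap 0 1))

theorem permOp_swap_mul_self :
    (permOp (Equiv.swap 0 1) : Op (Fin 2 → n)) * permOp (Equiv.swap 0 1) = 1 := by
  ext x y
  rw [permOp_mul_apply, permOp, Matrix.of_apply, Matrix.one_apply]
  refine if_congr ?_ rfl rfl
  simp [funext_iff, Fin.forall_fin_two, and_comm]

theorem isHermitian_permOp_swap : (permOp (Equiv.swap 0 1) : Op (Fin 2 → n)).IsHermitian := by
  ext x y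
  rw [Matrix.conjTranspose_apply, permOp_apply_symm, permOp, Matrix.of_apply, Equiv.symm_swap,
    apply_ite star, star_one, star_zero]

theorem isEffect_swapTest : IsEffect (swapTest n) := by
  have h : ∀ ε : ℂ, star ε = ε → ε * ε = 1 →
      ((2⁻¹ : ℂ) • (1 + ε • (permOp (Equiv.swap 0 1) : Op (Fin 2 → n)))).PosSemidef := by
    intro ε hε hε2
    set A := (2⁻¹ : ℂ) • (1 + ε • (permOp (Equiv.swap 0 1) : Op (Fin 2 → n))) with hA
    have hAA : A * Aᴴ = A := by
      have hAH : Aᴴ = A := by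
        rw [hA, Matrix.conjTranspose_smul, Matrix.conjTranspose_add, Matrix.conjTranspose_smul,
          Matrix.conjTranspose_one, isHermitian_permOp_swap.eq, hε, star_inv₀]
        simp
      rw [hAH, hA]
      simp only [Matrix.smul_mul, Matrix.mul_smul, Matrix.add_mul, Matrix.mul_add, Matrix.one_mul,
        Matrix.mul_one, permOp_swap_mul_self]
      linear_combination (norm := module)
        hε2 • ((2⁻¹ * 2⁻¹ : ℂ) • (1 : Op (Fin 2 → n)))
    rw [← hAA]
    exact Matrix.posSemidef_self_mul_conjTranspose A
  refine ⟨by simpa [swapTest] using h 1 (by simp) (by simp), ?_⟩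
  have h2 := h (-1) (by simp) (by simp)
  have h3 : (1 : Op (Fin 2 → n)) - swapTest n
      = (2⁻¹ : ℂ) • (1 + (-1 : ℂ) • (permOp (Equiv.swap 0 1) : Op (Fin 2 → n))) := by
    rw [swapTest]
    module
  rwa [h3]

theorem trace_swapTest_mul {ρ : Op n} (hρ : IsDensity ρ) :
    (swapTest n * tensorPower 2 ρ).trace = 2⁻¹ * (1 + (ρ * ρ).trace) := by
  have h : ((permOp (Equiv.swap 0 1) : Op (Fin 2 → n)) * tensorPower 2 ρ).trace
      = (ρ * ρ).trace := by
    refine (Fintype.sum_equiv (finTwoArrowEquiv n) _ (fun p : n × n => ρ p.1 p.2 * ρ p.2 p.1)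
      fun x => ?_).trans (Fintype.sum_prod_type _)
    rw [Matrix.diag_apply, permOp_mul_apply]
    simp [tensorPower, mul_comm]
  rw [swapTest, Matrix.smul_mul, Matrix.add_mul, Matrix.one_mul, Matrix.trace_smul,
    Matrix.trace_add, h, hρ.tensorPower.2, smul_eq_mul]

variable {a b : Type} [Fintype a] [DecidableEq a] [Fintype b] [DecidableEq b]

/-- The swap test on a bipartite system can be performed by comparing local swap tests. -/
theorem swapTest_prod : swapTest (a × b) = localProd (swapTest a) (swapTest b)
    + localProd (1 - swapTest a) (1 - swapTest b) := by
  have hp : ∀ x y : Fin 2 → a × b, (permOp (Equiv.swap 0 1) : Op (Fin 2 → a × b)) x y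
      = (permOp (Equiv.swap 0 1) : Op (Fin 2 → a)) (fun i => (x i).1) (fun i => (y i).1)
        * (permOp (Equiv.swap 0 1) : Op (Fin 2 → b)) (fun i => (x i).2) (fun i => (y i).2) := by
    intro x y
    simp only [permOp, Matrix.of_apply, ← ite_and, mul_ite, mul_one, mul_zero]
    refine if_congr ?_ rfl rfl
    simp only [funext_iff, Prod.ext_iff, Function.comp_apply, forall_and]
    tauto
  have h1 : ∀ x y : Fin 2 → a × b, (1 : Op (Fin 2 → a × b)) x y
      = (1 : Op (Fin 2 → a)) (fun i => (x i).1) (fun i => (y i).1)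
        * (1 : Op (Fin 2 → b)) (fun i => (x i).2) (fun i => (y i).2) := by
    intro x y
    simp only [Matrix.one_apply, ← ite_and, mul_ite, mul_one, mul_zero]
    refine if_congr ?_ rfl rfl
    simp only [funext_iff, Prod.ext_iff, forall_and]
    tauto
  ext x y
  change 2⁻¹ * ((1 : Op (Fin 2 → a × b)) x y + permOp _ x y)
    = (2⁻¹ * ((1 : Op (Fin 2 → a)) _ _ + permOp _ _ _))
        * (2⁻¹ * ((1 : Op (Fin 2 → b)) _ _ + permOp _ _ _))
      + ((1 : Op (Fin 2 → a)) _ _ - 2⁻¹ * ((1 : Op (Fin 2 → a)) _ _ + permOp _ _ _))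
        * ((1 : Op (Fin 2 → b)) _ _ - 2⁻¹ * ((1 : Op (Fin 2 → b)) _ _ + permOp _ _ _))
  rw [hp, h1]
  simp only [Equiv.arrowProdEquivProdArrow]
  ring_nf
  rfl

end SwapTest

section Blocks

variable {κ μ : Type} [Fintype κ] [DecidableEq κ] [Fintype μ] [DecidableEq μ] {n N : ℕ}

/-- Group `N` copies into blocks of `n` copies and blocks of two copies. -/
def blockEquiv (f : Fin N ≃ (κ × Fin n) ⊕ (μ × Fin 2)) (X : Type) :
    (Fin N → X) ≃ (κ → Fin n → X) × (μ → Fin 2 → X) :=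
  ((f.arrowCongr (Equiv.refl X)).trans (Equiv.sumArrowEquivProdArrow _ _ _)).trans
    ((Equiv.curry _ _ _).prodCongr (Equiv.curry _ _ _))

theorem tensorPower_eq_submatrix_blockEquiv (f : Fin N ≃ (κ × Fin n) ⊕ (μ × Fin 2)) {X : Type}
    (ρ : Op X) :
    tensorPower N ρ = ((piKron fun _ : κ => tensorPower n ρ) ⊗ₖ
      (piKron fun _ : μ => tensorPower 2 ρ)).submatrix (blockEquiv f X) (blockEquiv f X) := by
  ext x y
  change ∏ i, ρ (x i) (y i) = (∏ k : κ, ∏ i, ρ (x (f.symm (Sum.inl (k, i)))) _) *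
    ∏ j : μ, ∏ i, ρ (x (f.symm (Sum.inr (j, i)))) _
  rw [← Equiv.prod_comp f.symm, Fintype.prod_sum_type, Fintype.prod_prod_type,
    Fintype.prod_prod_type]
  rfl

variable {a b : Type} [Fintype a] [DecidableEq a] [Fintype b] [DecidableEq b]

theorem piKron_localProd (A : κ → Op (Fin n → a)) (B : κ → Op (Fin n → b))
    (x y : κ → Fin n → a × b) :
    piKron (fun k => localProd (A k) (B k)) x y
      = piKron A (fun k i => (x k i).1) (fun k i => (y k i).1)
        * piKron B (fun k i => (x k i).2) (fun k i => (y k i).2) :=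
  Finset.prod_mul_distrib

theorem localProd_one_one : localProd (1 : Op (Fin n → a)) (1 : Op (Fin n → b)) = 1 := by
  rw [localProd, Matrix.one_kronecker_one, Matrix.submatrix_one_equiv]

theorem thresholdEffect_localProd_one (t : ℕ) (L : Op (Fin n → a)) (x y : κ → Fin n → a × b) :
    thresholdEffect κ t (localProd L (1 : Op (Fin n → b))) x y
      = thresholdEffect κ t L (fun k i => (x k i).1) (fun k i => (y k i).1)
        * (1 : Op (κ → Fin n → b)) (fun k i => (x k i).2) (fun k i => (y k i).2) := by
  have h : (1 : Op (Fin n → a × b)) - localProd L 1 = localProd (1 - L) 1 := by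
    rw [← localProd_one_one]
    ext x y
    exact (sub_mul _ _ _).symm
  simp only [thresholdEffect, Matrix.sum_apply, Finset.sum_mul]
  refine Finset.sum_congr rfl fun I _ => ?_
  rw [← piKron_one (κ := κ) (n := Fin n → b), ← piKron_localProd]
  congr 2
  ext1 k
  rw [h]
  split_ifs <;> rfl

/-- A threshold test of a local effect of Alice, together with swap tests on further copies. -/
def blockTester (f : Fin N ≃ (κ × Fin n) ⊕ (μ × Fin 2)) (b : Type) [Fintype b] [DecidableEq b]
    (t : ℕ) (L : Op (Fin n → a)) : Op (Fin N → a × b) :=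
  (thresholdEffect κ t (localProd L (1 : Op (Fin n → b))) ⊗ₖ
    piKron fun _ : μ => swapTest (a × b)).submatrix (blockEquiv f _) (blockEquiv f _)

theorem IsEffect.localProd_one {L : Op (Fin n → a)} (hL : IsEffect L) :
    IsEffect (localProd L (1 : Op (Fin n → b))) :=
  (hL.kronecker isEffect_one).submatrix_equiv _

theorem isEffect_blockTester (f : Fin N ≃ (κ × Fin n) ⊕ (μ × Fin 2)) (t : ℕ)
    {L : Op (Fin n → a)} (hL : IsEffect L) : IsEffect (blockTester f b t L) :=
  ((isEffect_thresholdEffect t hL.localProd_one).kronecker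
    (IsEffect.piKron fun _ => isEffect_swapTest)).submatrix_equiv _

theorem trace_blockTester_mul (f : Fin N ≃ (κ × Fin n) ⊕ (μ × Fin 2)) (t : ℕ)
    {L : Op (Fin n → a)} (hL : IsEffect L) {ρ : Op (a × b)} (hρ : IsDensity ρ) :
    (blockTester f b t L * tensorPower N ρ).trace.re
      = binomialTail κ t (localProd L 1 * tensorPower n ρ).trace.re
        * ((1 + (ρ * ρ).trace.re) / 2) ^ Fintype.card μ := by
  have h2 : (swapTest (a × b) * tensorPower 2 ρ).trace
      = (((1 + (ρ * ρ).trace.re) / 2 : ℝ) : ℂ) := by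
    rw [trace_swapTest_mul hρ, Complex.ofReal_div, Complex.ofReal_add,
      ofReal_trace_mul_re hρ.1 hρ.1]
    push_cast
    ring
  rw [tensorPower_eq_submatrix_blockEquiv f ρ, blockTester, trace_submatrix_mul_submatrix,
    trace_kronecker_mul_kronecker, trace_thresholdEffect_mul t hL.localProd_one hρ.tensorPower,
    ← piKron_mul, trace_piKron]
  simp only [h2]
  rw [Finset.prod_const, Finset.card_univ, ← Complex.ofReal_pow, ← Complex.ofReal_mul,
    Complex.ofReal_re]

theorem isOneWayLOCC_blockTester (f : Fin N ≃ (κ × Fin n) ⊕ (μ × Fin 2)) (t : ℕ)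
    {L : Op (Fin n → a)} (hL : IsEffect L) : IsOneWayLOCC (blockTester f b t L) := by
  let e := (Fintype.equivFin (Finset μ)).symm
  let SA : Finset μ → μ → Op (Fin 2 → a) := fun I j => if j ∈ I then swapTest a else 1 - swapTest a
  let SB : Finset μ → μ → Op (Fin 2 → b) := fun I j => if j ∈ I then swapTest b else 1 - swapTest b
  have hSA : ∀ I j, IsEffect (SA I j) := by
    intro I j
    simp only [SA]
    split_ifs
    exacts [isEffect_swapTest, isEffect_swapTest.compl]
  have hSB : ∀ I j, IsEffect (SB I j) := by
    intro I j
    simp only [SB]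
    split_ifs
    exacts [isEffect_swapTest, isEffect_swapTest.compl]
  let B : Finset μ → Op (Fin N → b) := fun I =>
    ((1 : Op (κ → Fin n → b)) ⊗ₖ piKron (SB I)).submatrix (blockEquiv f b) (blockEquiv f b)
  let A : Finset μ → Op (Fin N → a) := fun I =>
    (thresholdEffect κ t L ⊗ₖ piKron (SA I)).submatrix (blockEquiv f a) (blockEquiv f a)
  refine ⟨_, fun m => B (e m), fun m => A (e m), fun m => ?_, ?_, fun m => ?_, ?_⟩
  · exact (Matrix.PosSemidef.one.kronecker
      (posSemidef_piKron fun j => (hSB (e m) j).1)).submatrix _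
  · rw [Equiv.sum_comp e B]
    have h : ∑ I, piKron (SB I) = 1 := by
      rw [← piKron_add]
      simp [piKron_one]
    have h2 : ∑ I, B I = ((1 : Op (κ → Fin n → b)) ⊗ₖ ∑ I, piKron (SB I)).submatrix
        (blockEquiv f b) (blockEquiv f b) := by
      ext x y
      simp [B, Matrix.sum_apply, Matrix.kroneckerMap_apply, Finset.mul_sum]
    rw [h2, h, Matrix.one_kronecker_one, Matrix.submatrix_one_equiv]
  · exact ((isEffect_thresholdEffect t hL).kronecker
      (IsEffect.piKron fun j => hSA (e m) j)).submatrix_equiv _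
  · rw [Equiv.sum_comp e fun I => localProd (A I) (B I)]
    have h : (piKron fun _ : μ => swapTest (a × b))
        = ∑ I, piKron fun j => localProd (SA I j) (SB I j) := by
      rw [swapTest_prod, piKron_add]
      refine Finset.sum_congr rfl fun I _ => congrArg piKron (funext fun j => ?_)
      simp only [SA, SB]
      split_ifs <;> rfl
    rw [blockTester, h]
    ext x y
    simp only [Matrix.submatrix_apply, Matrix.kroneckerMap_apply, Matrix.sum_apply, Finset.mul_sum,
      thresholdEffect_localProd_one, piKron_localProd]
    exact Finset.sum_congr rfl fun I _ => mul_mul_mul_comm _ _ _ _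

end Blocks

section SampleComplexity

variable {n : Type} [Fintype n] [DecidableEq n]

theorem exists_isTester_of_sampleComplexity_eq {P : Property n} {c s : ℝ} {N₀ : ℕ}
    (h : sampleComplexity P c s = N₀) :
    ∃ N ≤ N₀, ∃ T : Op (Fin N → n), IsTester P c s N T := by
  have hlt : sampleComplexity P c s < ((N₀ + 1 : ℕ) : ℕ∞) := by
    rw [h]
    exact_mod_cast Nat.lt_succ_self N₀
  simp only [sampleComplexity, iInf_lt_iff] at hlt
  obtain ⟨N, hT, hN⟩ := hlt
  exact ⟨N, Nat.lt_succ_iff.mp (by exact_mod_cast hN), hT⟩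

end SampleComplexity

section Parameters

theorem binomialTail_nonneg {κ : Type} [Fintype κ] (t : ℕ) {x : ℝ} (hx0 : 0 ≤ x) (hx1 : x ≤ 1) :
    0 ≤ binomialTail κ t x :=
  Finset.sum_nonneg fun _ _ => mul_nonneg (pow_nonneg hx0 _) (pow_nonneg (sub_nonneg.mpr hx1) _)

theorem binomialTail_le_one {κ : Type} [Fintype κ] (t : ℕ) {x : ℝ} (hx0 : 0 ≤ x) (hx1 : x ≤ 1) :
    binomialTail κ t x ≤ 1 := by
  rw [← sub_nonneg, one_sub_binomialTail]
  exact Finset.sum_nonneg fun _ _ =>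
    mul_nonneg (pow_nonneg hx0 _) (pow_nonneg (sub_nonneg.mpr hx1) _)

theorem two_le_log {s : ℝ} (hs : 0 < s) : 2 ≤ Real.log (1 / s + 10) := by
  have h : 0 < 1 / s := by positivity
  rw [Real.le_log_iff_exp_le (by positivity), show (2 : ℝ) = ((2 : ℕ) : ℝ) * 1 by norm_num,
    Real.exp_nat_mul]
  have h1 := Real.exp_one_lt_d9
  nlinarith [Real.exp_pos 1]

theorem exp_neg_log_le {s : ℝ} (hs : 0 < s) : Real.exp (-Real.log (1 / s + 10)) ≤ s := by
  have h : 0 < 1 / s := by positivity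
  rw [Real.exp_neg, Real.exp_log (by positivity)]
  exact inv_le_of_inv_le₀ hs (by rw [← one_div]; linarith)

/-- A threshold of `t` out of `K` trials that preserves success probabilities of at least `c`. -/
theorem le_binomialTail {κ : Type} [Fintype κ] {c g x : ℝ} (hg0 : 0 < g) (hgc : g ≤ c)
    (hg1 : g ≤ 1) (hcx : c ≤ x) (hx1 : x ≤ 1) (hK : 160 / g ^ 3 ≤ Fintype.card κ) :
    c ≤ binomialTail κ ⌈(Fintype.card κ : ℝ) * (c - g / 4)⌉₊ x := by
  set K := Fintype.card κ with hKdef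
  set t := ⌈(K : ℝ) * (c - g / 4)⌉₊ with ht
  have hK0 : (0 : ℝ) ≤ K := Nat.cast_nonneg K
  have htK : t ≤ K := by
    rw [ht, Nat.ceil_le]
    exact mul_le_of_le_one_right hK0 (by linarith)
  have ht1 : (t : ℝ) < K * (c - g / 4) + 1 := Nat.ceil_lt_add_one (mul_nonneg hK0 (by linarith))
  have hcast : ((K + 1 - t : ℕ) : ℝ) = K + 1 - t := by
    rw [Nat.cast_sub (by omega)]
    push_cast
    ring
  have h := one_sub_binomialTail_le (κ := κ) (t := t) (t' := K + 1 - t) (x := x) (g := g / 4)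
    (by linarith) hx1 (by linarith) (by linarith) (by omega) (by omega) (by
      rw [hcast, ← hKdef]
      have : (K : ℝ) * (1 - x + g / 4) ≤ K * (1 - c + g / 4) :=
        mul_le_mul_of_nonneg_left (by linarith) hK0
      linarith)
  have hexp : (1 + g / 4) / (g / 4) * Real.exp (-(K * (g / 4) ^ 2 / 2)) ≤ 1 := by
    have h1 : (1 + g / 4) / (g / 4) ≤ 5 / g := by
      rw [div_le_div_iff₀ (by linarith) hg0]
      nlinarith
    have h2 : 5 / g ≤ Real.exp (K * (g / 4) ^ 2 / 2) := by
      refine le_trans ?_ ((lt_add_one _).le.trans (Real.add_one_le_exp _))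
      calc 5 / g = 160 / g ^ 3 * (g / 4) ^ 2 / 2 := by field_simp; norm_num
        _ ≤ _ := by gcongr
    rw [Real.exp_neg, ← div_eq_mul_inv]
    exact (div_le_one (Real.exp_pos _)).mpr (h1.trans h2)
  have h3 : (1 - x) * ((1 + g / 4) / (g / 4) * Real.exp (-(K * (g / 4) ^ 2 / 2))) ≤ 1 - x :=
    mul_le_of_le_one_right (by linarith) hexp
  rw [← hKdef] at h
  linarith

/-- The number of copies used is within the required bound. -/
theorem copies_le {n : ℕ} {Λ g : ℝ} (hΛ : 2 ≤ Λ) (hg0 : 0 < g) (hg1 : g ≤ 1) :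
    ((⌈80 * Λ / g ^ 3⌉₊ * n + ⌈8 * n * Λ / g⌉₊ * 2 : ℕ) : ℝ) ≤ 200 * Λ / g ^ 4 * n := by
  rcases Nat.eq_zero_or_pos n with rfl | hn
  · simp
  have hn1 : (1 : ℝ) ≤ n := by exact_mod_cast hn
  have hK : (⌈80 * Λ / g ^ 3⌉₊ : ℝ) ≤ 80 * Λ / g ^ 3 + 1 :=
    (Nat.ceil_lt_add_one (by positivity)).le
  have hr : (⌈8 * n * Λ / g⌉₊ : ℝ) ≤ 8 * n * Λ / g + 1 :=
    (Nat.ceil_lt_add_one (by positivity)).le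
  have h3 : Λ / g ^ 3 ≤ Λ / g ^ 4 :=
    div_le_div_of_nonneg_left (by linarith) (by positivity)
      (pow_le_pow_of_le_one hg0.le hg1 (by norm_num))
  have h1 : Λ / g ≤ Λ / g ^ 4 :=
    div_le_div_of_nonneg_left (by linarith) (by positivity)
      (pow_le_of_le_one hg0.le hg1 (by norm_num))
  have h0 : 2 ≤ Λ / g ^ 4 :=
    hΛ.trans (le_div_self (by linarith) (by positivity) (pow_le_one₀ hg0.le hg1))
  push_cast
  calc (⌈80 * Λ / g ^ 3⌉₊ : ℝ) * n + ⌈8 * n * Λ / g⌉₊ * 2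
      ≤ (80 * Λ / g ^ 3 + 1) * n + (8 * n * Λ / g + 1) * 2 := by gcongr
    _ ≤ (80 * Λ / g ^ 3 + 1) * n + (8 * n * Λ / g + n) * 2 := by gcongr
    _ = (80 * (Λ / g ^ 3) + 16 * (Λ / g) + 3) * n := by ring
    _ ≤ (200 * (Λ / g ^ 4)) * n := by
        gcongr
        linarith
    _ = _ := by ring

end Parameters

section Main

variable {a b : Type} [Fintype a] [DecidableEq a] [Fintype b] [DecidableEq b]

theorem exists_oneWayLOCC_isTester {P : Property (a × b)} (hinv : UnitarilyInvariantOnB P)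
    (hpure : ∀ ρ ∈ P.yes, IsPure ρ) {c s : ℝ} (hs : 0 < s) (hsc : s < c) (hc : c ≤ 1) {n : ℕ}
    (hP : ∃ T : Op (Fin n → a × b), IsTester P c s n T) :
    ∃ (N : ℕ) (T : Op (Fin N → a × b)), IsTester P c s N T ∧ IsOneWayLOCC T ∧
      (N : ℝ) ≤ 200 * Real.log (1 / s + 10) / (c - s) ^ 4 * n := by
  obtain ⟨T, hT, hTU⟩ := exists_invariant_isTester hinv hP
  obtain ⟨L, hL, hLT⟩ := exists_local_effect hT.1 hTU
  set g := c - s with hg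
  set Λ := Real.log (1 / s + 10) with hΛ
  have hg0 : 0 < g := by linarith
  have hg1 : g ≤ 1 := by linarith
  have hΛ2 : 2 ≤ Λ := two_le_log hs
  have hΛs : Real.exp (-Λ) ≤ s := exp_neg_log_le hs
  set K := ⌈80 * Λ / g ^ 3⌉₊ with hK
  set r := ⌈8 * n * Λ / g⌉₊ with hr
  have hKge : 80 * Λ / g ^ 3 ≤ K := Nat.le_ceil _
  have hrge : 8 * n * Λ / g ≤ r := Nat.le_ceil _
  have hK160 : 160 / g ^ 3 ≤ (Fintype.card (Fin K) : ℝ) := by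
    rw [Fintype.card_fin]
    refine le_trans ?_ hKge
    gcongr
    linarith
  let f : Fin (K * n + r * 2) ≃ (Fin K × Fin n) ⊕ (Fin r × Fin 2) :=
    (Fintype.equivFinOfCardEq (by simp)).symm
  set t := ⌈(Fintype.card (Fin K) : ℝ) * (c - g / 4)⌉₊ with ht
  refine ⟨K * n + r * 2, blockTester f b t L,
    ⟨isEffect_blockTester f t hL, fun ρ hρ => ?_, fun ρ hρ => ?_⟩,
    isOneWayLOCC_blockTester f t hL, copies_le hΛ2 hg0 hg1⟩
  · have hd := P.yes_density ρ hρ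
    have hℓ : c ≤ (localProd L 1 * tensorPower n ρ).trace.re := by
      obtain ⟨ψ, -, hψ⟩ := hpure ρ hρ
      have h := hT.2.1 ρ hρ
      rwa [hψ, ← hLT, ← hψ] at h
    have hℓ1 : (localProd L 1 * tensorPower n ρ).trace.re ≤ 1 := by
      have h := hL.localProd_one (b := b) |>.trace_mul_re_le (hd.tensorPower (N := n)).1
      rwa [hd.tensorPower.2, Complex.one_re] at h
    rw [trace_blockTester_mul f t hL hd, (hpure ρ hρ).trace_mul_self, Complex.one_re,
      show ((1 : ℝ) + 1) / 2 = 1 by norm_num, one_pow, mul_one]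
    exact le_binomialTail hg0 (by linarith) hg1 hℓ hℓ1 hK160
  · have hd := P.no_density ρ hρ
    obtain ⟨p, ψ, hp0, hp1, hψ, hpψ, hpur⟩ := hd.exists_top_eigenvector
    have hE := hL.localProd_one (b := b)
    set x := (localProd L 1 * tensorPower n ρ).trace.re with hx
    have hx0 : 0 ≤ x := trace_mul_re_nonneg hE.1 hd.tensorPower.1
    have hx1 : x ≤ 1 := by
      have h := hE.trace_mul_re_le (hd.tensorPower (N := n)).1
      rwa [hd.tensorPower.2, Complex.one_re] at h
    have hxs : x ≤ s + n * (1 - p) := by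
      have h := trace_mul_tensorPower_le hE hT.1.1 hLT hd hp0 hψ hpψ
      linarith [hT.2.2 ρ hρ]
    have hpur0 : 0 ≤ (ρ * ρ).trace.re := trace_mul_re_nonneg hd.1 hd.1
    have hq0 : 0 ≤ (1 + (ρ * ρ).trace.re) / 2 := by linarith
    have htail0 := binomialTail_nonneg (κ := Fin K) t hx0 hx1
    rw [trace_blockTester_mul f t hL hd, ← hx, Fintype.card_fin]
    refine le_trans ?_ hΛs
    by_cases hcase : n * (1 - p) ≤ g / 4
    · refine (mul_le_of_le_one_right htail0 (pow_le_one₀ hq0 (by linarith))).trans ?_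
      have hxg : x + g / 2 ≤ c - g / 4 := by linarith
      refine (binomialTail_le_exp hx0 (half_pos hg0) (by linarith) ?_).trans ?_
      · exact (mul_le_mul_of_nonneg_left hxg (Nat.cast_nonneg _)).trans (Nat.le_ceil _)
      · rw [Real.exp_le_exp, neg_le_neg_iff, Fintype.card_fin]
        calc Λ ≤ 10 * Λ / g := by
              rw [le_div_iff₀ hg0]
              nlinarith
          _ = 80 * Λ / g ^ 3 * (g / 2) ^ 2 / 2 := by field_simp; norm_num
          _ ≤ _ := by gcongr
    · push Not at hcase
      refine (mul_le_of_le_one_left (pow_nonneg hq0 _) (binomialTail_le_one t hx0 hx1)).trans ?_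
      have hq : (1 + (ρ * ρ).trace.re) / 2 ≤ Real.exp (-((1 - p) / 2)) := by
        refine le_trans ?_ (Real.add_one_le_exp _)
        linarith
      refine (pow_le_pow_left₀ hq0 hq r).trans ?_
      rw [← Real.exp_nat_mul, Real.exp_le_exp]
      have h : Λ ≤ r * ((1 - p) / 2) := by
        calc Λ = 4 * Λ / g * (g / 4) := by field_simp
          _ ≤ 4 * Λ / g * (n * (1 - p)) := by gcongr
          _ = 8 * n * Λ / g * ((1 - p) / 2) := by ring
          _ ≤ r * ((1 - p) / 2) := by gcongr
      linarith

end Main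

end StateTesting

end

theorem theorem6p1 (dA dB : ℕ) (P : StateTesting.Property (Fin dA × Fin dB))
    (hinv : StateTesting.UnitarilyInvariantOnB P)
    (hpure : ∀ ρ ∈ P.yes, StateTesting.IsPure ρ)
    (c s : ℝ) (hs : 0 < s) (hsc : s < c) (hc : c ≤ 1)
    (N₀ : ℕ) (hN₀ : StateTesting.sampleComplexity P c s = (N₀ : ℕ∞)) :
    ∃ (N : ℕ) (T : StateTesting.Op (Fin N → Fin dA × Fin dB)),
      StateTesting.IsTester P c s N T ∧
      StateTesting.IsOneWayLOCC T ∧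
      (N : ℝ) ≤ 200 * Real.log (1 / s + 10) / (c - s) ^ 4 * (N₀ : ℝ) := by
  obtain ⟨n, hn, hP⟩ := StateTesting.exists_isTester_of_sampleComplexity_eq hN₀
  obtain ⟨N, T, hT, hLOCC, hN⟩ :=
    StateTesting.exists_oneWayLOCC_isTester hinv hpure hs hsc hc hP
  refine ⟨N, T, hT, hLOCC, hN.trans (mul_le_mul_of_nonneg_left (Nat.cast_le.mpr hn) ?_)⟩
  have := StateTesting.two_le_log hs
  positivity
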